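/- Let $n\ge 1$ and let $\Phi:\mathbb R^n\to[0,1]$ be a smooth radial function with $\operatorname{supp}\Phi\subseteq\{|\xi|\le 2\}$ and $\Phi(\xi)=1$ for $|\xi|\le 1$. Put $\psi(\xi)=\Phi(\xi)-\Phi(2\xi)$, let $\mathscr F f(\xi)=\int_{\mathbb R^n} e^{-ix\cdot\xi}f(x)\,dx$, and for $f\in\mathcal S'(\mathbb R^n)$ let $P_{\le 0}f=\mathscr F^{-1}\Phi(\xi)\mathscr F f$ and $\triangle_k f=\mathscr F^{-1}\psi(2^{-k}\xi)\mathscr F f$. For $s\in\mathbb R$ and $1\le p,q\le\infty$ let $$\|f\|_{B^s_{p,q}}=\Big(\|P_{\le 0}f\|_{L^p}^q+\sum_{k=1}^\infty 2^{ksq}\|\triangle_k f\|_{L^p}^q\Big)^{1/q}\in[0,\infty]$$ (for $q=\infty$: the maximum of $\|P_{\le 0}f\|_{L^p}$ and $\sup_{k\ge 1}2^{ks}\|\triangle_k f\|_{L^p}$), where the $L^p$ norm of a distribution not in $L^p$ is $\infty$; thus $B^s_{p,q}$ is the set of $f\in\mathcal S'(\mathbb R^n)$ with $\|f\|_{B^s_{p,q}}<\infty$.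 Let $B(t)=\omega^{-1}\sin(t\omega)$, $\omega=\sqrt{I+\Delta^2}$, be the operator on $\mathcal S'(\mathbb R^n)$ given by $B(t)g=\mathscr F^{-1}\,\frac{\sin(t\sqrt{1+|\xi|^4})}{\sqrt{1+|\xi|^4}}\,\mathscr F g$. Then there is a constant $C$, depending only on $n$ and $\Phi$, such that for all $2\le p\le\infty$, $\frac1p+\frac1{p'}=1$, $1\le q\le\infty$, all $s,s'\in\mathbb R$ with $0\le 2+s'-s$, all $t\in\mathbb R$ and all $g\in\mathcal S'(\mathbb R^n)$, $$\|B(t)g\|_{B^s_{p,q}}\le C\,k(t)\,\|g\|_{B^{s'}_{p',q}},\qquad \delta=\tfrac12-\tfrac1p,\qquad k(t)=\begin{cases}|t|^{\min(1+\frac{s'}2-\frac s2-n\delta,\;0)},&|t|\le 1,\\ |t|^{-\frac{n\delta}{2}},&|t|\ge 1,\end{cases}$$ where $0^{-a}=\infty$ for $a>0$ and $\infty\cdot 0=0$ (at $t=0$ the left-hand side is $0$). In particular, for $t\ne 0$, $B(t)$ maps $B^{s'}_{p',q}$ into $B^s_{p,q}$. -/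

import Mathlib

open MeasureTheory
open scoped ENNReal NNReal SchwartzMap

noncomputable section

namespace BeamBesov

/-- Euclidean space `ℝⁿ`. -/
abbrev Eucl (n : ℕ) : Type := EuclideanSpace ℝ (Fin n)

/-- Admissible low-frequency cutoffs: smooth radial functions `Φ : ℝⁿ → [0,1]`, supported in
`|ξ| ≤ 2` and equal to `1` on `|ξ| ≤ 1`. (A radial function is automatically even.) -/
structure IsCutoff {n : ℕ} (Φ : Eucl n → ℝ) : Prop where
  smooth : ContDiff ℝ ((⊤ : ℕ∞) : WithTop ℕ∞) Φ
  radial : ∀ ξ η : Eucl n, ‖ξ‖ = ‖η‖ → Φ ξ = Φ η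
  nonneg : ∀ ξ, 0 ≤ Φ ξ
  le_one : ∀ ξ, Φ ξ ≤ 1
  supp : tsupport Φ ⊆ Metric.closedBall 0 2
  eq_one : ∀ ξ, ‖ξ‖ ≤ 1 → Φ ξ = 1

/-- The operator `𝓕⁻¹ m(ξ) 𝓕` on tempered distributions, `ξ` being the angular frequency
(`𝓕 f(ξ) = ∫ e^{-i x·ξ} f(x) dx`, so that `-Δ` has symbol `|ξ|²`). Mathlib's Fourier transform is
`∫ e^{-2π i x·ξ} f(x) dx`, which accounts for the factor `2π`. -/
def multiplier {n : ℕ} (m : Eucl n → ℝ) : 𝓢'(Eucl n, ℂ) →L[ℂ] 𝓢'(Eucl n, ℂ) :=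
  TemperedDistribution.fourierMultiplierCLM ℂ
    (fun ξ : Eucl n => ((m ((2 * Real.pi) • ξ) : ℝ) : ℂ))

/-- `P_{≤ 0}`, the multiplier with symbol `Φ`. -/
def lowProj {n : ℕ} (Φ : Eucl n → ℝ) : 𝓢'(Eucl n, ℂ) →L[ℂ] 𝓢'(Eucl n, ℂ) :=
  multiplier Φ

/-- The Littlewood-Paley projector `Δ_k`, the multiplier with symbol `ψ(2^{-k} ξ)`, where
`ψ(ξ) = Φ(ξ) - Φ(2ξ)`. -/
def dyadicProj {n : ℕ} (Φ : Eucl n → ℝ) (k : ℤ) : 𝓢'(Eucl n, ℂ) →L[ℂ] 𝓢'(Eucl n, ℂ) :=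
  multiplier (fun ξ => Φ ((2 : ℝ) ^ (-k) • ξ) - Φ ((2 : ℝ) • ((2 : ℝ) ^ (-k) • ξ)))

/-- The `Lᵖ` norm of a tempered distribution (`1 ≤ p ≤ ∞`): it is `‖h‖_{Lᵖ}` if the distribution is
given by integration against `h ∈ Lᵖ`, and `∞` if there is no such `h`. -/
def distLpNorm {n : ℕ} (p : ℝ≥0∞) (u : 𝓢'(Eucl n, ℂ)) : ℝ≥0∞ :=
  ⨅ (h : Eucl n → ℂ) (_ : MemLp h p volume)
    (_ : ∀ φ : 𝓢(Eucl n, ℂ), u φ = ∫ x, φ x * h x), eLpNorm h p volume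

/-- The norm of the inhomogeneous Besov space `B^s_{p,q}`, with values in `[0,∞]`; a tempered
distribution belongs to `B^s_{p,q}` if and only if this norm is finite. The dyadic sum runs over
`k + 1` with `k ≥ 0`; for `q = ∞` the `ℓ^q` norm is a supremum. -/
def besovNorm {n : ℕ} (Φ : Eucl n → ℝ) (s : ℝ) (p q : ℝ≥0∞) (f : 𝓢'(Eucl n, ℂ)) : ℝ≥0∞ :=
  if q = ∞ then
    max (distLpNorm p (lowProj Φ f))
      (⨆ k : ℕ, (2 : ℝ≥0∞) ^ (((k + 1 : ℕ) : ℝ) * s) *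
        distLpNorm p (dyadicProj Φ ((k + 1 : ℕ) : ℤ) f))
  else
    (distLpNorm p (lowProj Φ f) ^ q.toReal +
      ∑' k : ℕ, (2 : ℝ≥0∞) ^ (((k + 1 : ℕ) : ℝ) * s * q.toReal) *
        distLpNorm p (dyadicProj Φ ((k + 1 : ℕ) : ℤ) f) ^ q.toReal) ^ (1 / q.toReal)

/-- The symbol `√(1 + |ξ|⁴)` of `ω = √(I + Δ²)`. -/
def omegaSymbol {n : ℕ} (ξ : Eucl n) : ℝ := Real.sqrt (1 + ‖ξ‖ ^ 4)

/-- The symbol of `B(t) = ω⁻¹ sin(tω)`. -/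
def beamSymbol {n : ℕ} (t : ℝ) (ξ : Eucl n) : ℝ :=
  (omegaSymbol ξ)⁻¹ * Real.sin (t * omegaSymbol ξ)

/-- The beam operator `B(t) = ω⁻¹ sin(tω)`, `ω = √(I + Δ²)`, on tempered distributions. -/
def beamOp {n : ℕ} (t : ℝ) : 𝓢'(Eucl n, ℂ) →L[ℂ] 𝓢'(Eucl n, ℂ) :=
  multiplier (beamSymbol t)

/-- The exponent `δ = 1/2 - 1/p`. -/
def delta (p : ℝ≥0∞) : ℝ := 1 / 2 - (p⁻¹).toReal

/-- The decay factor `k(t)`, with values in `[0,∞]`; a negative power of `0` is `∞`. -/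
def decayFactor (n : ℕ) (p : ℝ≥0∞) (s s' t : ℝ) : ℝ≥0∞ :=
  if |t| ≤ 1 then
    ENNReal.ofReal |t| ^ (min (1 + s' / 2 - s / 2 - n * delta p) 0)
  else
    ENNReal.ofReal |t| ^ (-(n * delta p / 2))

theorem abs_iteratedDeriv_sin_cos_le_one (n : ℕ) : ∀ x, |iteratedDeriv n Real.sin x| ≤ 1 ∧ |iteratedDeriv n Real.cos x| ≤ 1 := by
  induction n with
  | zero => intro x; simp [Real.abs_sin_le_one, Real.abs_cos_le_one]
  | succ k ih =>
    intro x
    rw [Real.iteratedDeriv_add_one_sin, Real.iteratedDeriv_add_one_cos]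
    exact ⟨(ih x).2, by simpa using (ih x).1⟩

theorem hasTemperateGrowth_sin : Real.sin.HasTemperateGrowth := by
  refine ⟨Real.contDiff_sin, fun n => ⟨0, 1, fun x => ?_⟩⟩
  rw [norm_iteratedFDeriv_eq_norm_iteratedDeriv]
  simpa using (abs_iteratedDeriv_sin_cos_le_one n x).1

theorem hasTemperateGrowth_omega_rpow {n : ℕ} (r : ℝ) :
    (fun ξ : Eucl n => (1 + ‖(‖ξ‖ ^ 2 : ℝ)‖ ^ 2) ^ r).HasTemperateGrowth :=
  (Function.hasTemperateGrowth_one_add_norm_sq_rpow ℝ r).comp (Function.hasTemperateGrowth_norm_sq (Eucl n))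

theorem omegaSymbol_eq_rpow {n : ℕ} (ξ : Eucl n) : omegaSymbol ξ = (1 + ‖(‖ξ‖ ^ 2 : ℝ)‖ ^ 2) ^ (1/2 : ℝ) := by
  rw [omegaSymbol, Real.sqrt_eq_rpow]; congr 2; simp; ring

theorem hasTemperateGrowth_omegaSymbol {n : ℕ} : (omegaSymbol (n := n)).HasTemperateGrowth := by
  have := hasTemperateGrowth_omega_rpow (n := n) (1/2)
  rwa [show omegaSymbol (n := n) = _ from funext omegaSymbol_eq_rpow]

/-- The symbol of `B(t)` is smooth with derivatives of polynomial growth, so `B(t)` is a genuine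
operator on tempered distributions. -/
theorem hasTemperateGrowth_beamSymbol {n : ℕ} (t : ℝ) : (beamSymbol (n := n) t).HasTemperateGrowth := by
  have h1 : (fun ξ : Eucl n => (omegaSymbol ξ)⁻¹).HasTemperateGrowth := by
    have := hasTemperateGrowth_omega_rpow (n := n) (-(1/2))
    convert this using 2 with ξ
    rw [omegaSymbol_eq_rpow, Real.rpow_neg (by positivity)]
  have h2 : (fun ξ : Eucl n => t * omegaSymbol ξ).HasTemperateGrowth :=
    (Function.HasTemperateGrowth.const t).mul hasTemperateGrowth_omegaSymbol
  exact h1.mul (hasTemperateGrowth_sin.comp h2)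

theorem hasTemperateGrowth_rescaled {n : ℕ} {m : Eucl n → ℝ} (h : m.HasTemperateGrowth) :
   (fun ξ : Eucl n => ((m ((2 * Real.pi) • ξ) : ℝ) : ℂ)).HasTemperateGrowth := by
  have h2 : (fun ξ : Eucl n => (2 * Real.pi) • ξ).HasTemperateGrowth := by fun_prop
  exact Function.Complex.hasTemperateGrowth_ofReal.comp (h.comp h2)

open Laplacian in
/-- The operator with symbol `omegaSymbol` squares to `I + Δ²`. -/
theorem multiplier_omegaSymbol_sq {n : ℕ} (f : 𝓢'(Eucl n, ℂ)) :
    multiplier omegaSymbol (multiplier omegaSymbol f) = f + Δ (Δ f) := by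
  have hs : (fun x : Eucl n ↦ Complex.ofReal (‖x‖ ^ 2)).HasTemperateGrowth := by fun_prop
  rw [multiplier, TemperedDistribution.fourierMultiplierCLM_fourierMultiplierCLM_apply (hasTemperateGrowth_rescaled hasTemperateGrowth_omegaSymbol) (hasTemperateGrowth_rescaled hasTemperateGrowth_omegaSymbol)]
  rw [TemperedDistribution.laplacian_eq_fourierMultiplierCLM, TemperedDistribution.laplacian_eq_fourierMultiplierCLM,
    ContinuousLinearMap.map_smul_of_tower, smul_smul,TemperedDistribution.fourierMultiplierCLM_fourierMultiplierCLM_apply hs hs]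
  rw [← Complex.coe_smul, ← smul_apply, ← TemperedDistribution.fourierMultiplierCLM_smul (hs.mul hs)]
  nth_rewrite 2 [show f = TemperedDistribution.fourierMultiplierCLM ℂ (fun _ : Eucl n => (1:ℂ)) f by simp]
  simp only [TemperedDistribution.fourierMultiplierCLM_apply]
  rw [← FourierTransform.fourierInv_add, ← _root_.add_apply, ← TemperedDistribution.smulLeftCLM_add]
  · congr 2
    congr 1
    ext ξ
    simp only [Pi.mul_apply, Pi.add_apply, Pi.smul_apply, omegaSymbol, smul_eq_mul]
    rw [← Complex.ofReal_mul, Real.mul_self_sqrt (by positivity), norm_smul]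
    simp [abs_of_pos Real.pi_pos]; ring
  · fun_prop
  · exact (Function.HasTemperateGrowth.const _).mul (hs.mul hs)

end BeamBesov

end

/-! The estimate is diagonal in frequency. Since `B(t)` commutes with the projections and both Besov
norms use the same q, it suffices to bound each block from L^{p'} to L^p (`besovNorm_le_of_blocks`).
On a block of size ρ the L²→L² norm is at most the sup of the symbol and the L¹→L^∞ norm at most the
sup of the kernel. Riesz-Thorin (`norm_le_interp_simpleFunc`, `eLpNorm_schwartzConv_le`) combines
them with weights 1 - 2δ and 2δ.

The core is a kernel bound uniform in ρ. Put ξ = ρζ and τ = ρ²/(1 + ρ²). Then ω(ρζ) = (1 + ρ²) σ(ζ)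
with σ = √((1 - τ)² + τ²|ζ|⁴), and tω = l σ/τ² with l = tρ⁴/(1 + ρ²). The phase σ/τ² has gradient
g(ζ)ζ, g = 2|ζ|²/σ, which stays smooth and strictly monotone on an annulus for every τ in the closed
interval [0,1]: it interpolates between the gradients of |ζ|⁴/2 (τ = 0) and of |ζ|² (τ = 1).
Compactness in τ makes the constants uniform.

No stationary phase expansion is needed. The squared modulus of the oscillatory integral is at most
the integral over η of the modulus of the autocorrelation of its integrand
(`norm_integral_sq_le_autocorrelation`). There the linear phase x·ζ leaves only a unimodular
constant, and monotonicity says that the phase increment has derivative comparable to |η| in the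
direction of η. Integrating by parts n + 1 times gives decay (1 + |l||η|)^{-(n+1)}. Integrating in η
gives |l|^{-n}, and the square root is the dispersive bound |l|^{-n/2}
(`exists_waveIntegrand_bound`).

For ρ ≥ 1 this yields the kernel bound ρ^{-2} min(ρ^n, |t|^{-n/2}). For ρ ≤ 1 it yields
ρ^{-n}|t|^{-n/2}, which degenerates at the origin. Summing dyadically down to radius |t|^{-1/4} and
bounding the remaining ball by its volume gives |t|^{-n/4} at low frequency, the source of the
exponent nδ/2 for large times. The condition 0 ≤ 2 + s' - s then lets ρ^{-2} min(ρ^n,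
|t|^{-n/2})^{2δ} be absorbed into k(t) ρ^{s'-s}. -/

noncomputable section

namespace BeamBesov

/-! ### Riesz-Thorin interpolation and the converse of Hölder's inequality -/

section Interpolation

/-- The analytic family `c ↦ (c / |c|) |c| ^ w`, vanishing at `c = 0`. -/
def signedCpow (w c : ℂ) : ℂ := if c = 0 then 0 else c / ‖c‖ * Complex.exp (w * Real.log ‖c‖)

theorem signedCpow_zero (w : ℂ) : signedCpow w 0 = 0 := by simp [signedCpow]

theorem signedCpow_one (c : ℂ) : signedCpow 1 c = c := by
  unfold signedCpow
  split_ifs with h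
  · exact h.symm
  · have h' : (0 : ℝ) < ‖c‖ := norm_pos_iff.2 h
    rw [one_mul, ← Complex.ofReal_exp, Real.exp_log h']
    exact div_mul_cancel₀ _ (by exact_mod_cast h'.ne')

theorem norm_signedCpow {w c : ℂ} (hw : 0 < w.re) : ‖signedCpow w c‖ = ‖c‖ ^ w.re := by
  unfold signedCpow
  split_ifs with h
  · simp [h, Real.zero_rpow hw.ne']
  · have h' : (0 : ℝ) < ‖c‖ := norm_pos_iff.2 h
    rw [norm_mul, norm_div, Complex.norm_exp, Complex.re_mul_ofReal, Real.rpow_def_of_pos h',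
      mul_comm w.re]
    simp [h]

theorem differentiable_signedCpow (c : ℂ) : Differentiable ℂ (fun w => signedCpow w c) := by
  unfold signedCpow
  split_ifs with h <;> fun_prop

theorem norm_signedCpow_le {w c : ℂ} {b : ℝ} (hw : 0 < w.re) (hb : w.re ≤ b) :
    ‖signedCpow w c‖ ≤ (1 + ‖c‖) ^ b := by
  rw [norm_signedCpow hw]
  calc ‖c‖ ^ w.re ≤ (1 + ‖c‖) ^ w.re := by gcongr; linarith
    _ ≤ (1 + ‖c‖) ^ b := Real.rpow_le_rpow_of_exponent_le (by linarith [norm_nonneg c]) hb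

/-- The modulus of the family sees only `w.re`. Hence the norms are constant along each vertical
line and are powers of one norm of `f`, so the three lines argument needs no normalisation of `f`.
-/
theorem eLpNorm_map_signedCpow {α : Type*} [MeasurableSpace α] {μ : Measure α} (f : SimpleFunc α ℂ)
    {w : ℂ} (hw : 0 < w.re) (p : ℝ≥0∞) :
    eLpNorm (f.map (signedCpow w)) p μ = eLpNorm f (p * ENNReal.ofReal w.re) μ ^ w.re := by
  rw [← eLpNorm_norm_rpow _ hw]
  apply eLpNorm_congr_norm_ae
  refine Filter.Eventually.of_forall fun x => ?_
  simp only [SimpleFunc.map_apply, norm_signedCpow hw, Real.norm_eq_abs]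
  rw [abs_of_nonneg (by positivity)]

/-- Riesz-Thorin interpolation between `(1, 1)` and `(2, 2)` for a bilinear form on simple
functions. -/
theorem norm_le_interp_simpleFunc {α β : Type*} [MeasurableSpace α] [MeasurableSpace β]
    {μ : Measure α} {ν : Measure β} (Λ : SimpleFunc α ℂ → SimpleFunc β ℂ → ℂ)
    (f : SimpleFunc α ℂ) (g : SimpleFunc β ℂ) (L : ℂ → ℂ → ℂ) {A₁ A₂ r : ℝ}
    (hA₁ : 0 ≤ A₁) (hA₂ : 0 ≤ A₂) (hr1 : 1 ≤ r) (hr2 : r ≤ 2)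
    (hexp : ∀ G H : ℂ → ℂ, G 0 = 0 → H 0 = 0 →
      Λ (f.map G) (g.map H) = ∑ c ∈ f.range, ∑ d ∈ g.range, G c * H d * L c d)
    (h1 : ∀ G H : ℂ → ℂ, G 0 = 0 → H 0 = 0 → ‖Λ (f.map G) (g.map H)‖ ≤
      A₁ * ((eLpNorm (f.map G) 1 μ).toReal * (eLpNorm (g.map H) 1 ν).toReal))
    (h2 : ∀ G H : ℂ → ℂ, G 0 = 0 → H 0 = 0 → ‖Λ (f.map G) (g.map H)‖ ≤
      A₂ * ((eLpNorm (f.map G) 2 μ).toReal * (eLpNorm (g.map H) 2 ν).toReal)) :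
    ‖Λ f g‖ ≤ A₂ ^ (2 - 2 / r) * A₁ ^ (2 / r - 1) *
      ((eLpNorm f (ENNReal.ofReal r) μ).toReal * (eLpNorm g (ENNReal.ofReal r) ν).toReal) := by
  -- This affine exponent has real part r/2 on the line Re z = 0 (L² norms), real part r on Re z = 1
  -- (L¹ norms), and equals 1 at z = 2/r - 1, where the original functions are recovered.
  set W : ℂ → ℂ := fun z => (r / 2 : ℝ) * (1 + z) with hW
  have hr0 : 0 < r := by linarith
  have hWre : ∀ z, (W z).re = r / 2 * (1 + z.re) := by
    intro z; simp only [hW]; rw [Complex.re_ofReal_mul]; simp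
  set F : ℂ → ℂ := fun z => Λ (f.map (signedCpow (W z))) (g.map (signedCpow (W z))) with hF
  have hFe : ∀ z, F z = ∑ c ∈ f.range, ∑ d ∈ g.range,
      signedCpow (W z) c * signedCpow (W z) d * L c d := fun z =>
    hexp _ _ (signedCpow_zero _) (signedCpow_zero _)
  set Nf := (eLpNorm f (ENNReal.ofReal r) μ).toReal with hNf
  set Ng := (eLpNorm g (ENNReal.ofReal r) ν).toReal with hNg
  have hNf0 : 0 ≤ Nf := ENNReal.toReal_nonneg
  have hNg0 : 0 ≤ Ng := ENNReal.toReal_nonneg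
  have hθ : W ((2 / r - 1 : ℝ) : ℂ) = 1 := by
    apply Complex.ext
    · rw [hWre]; simp; field_simp
    · simp [hW, Complex.mul_im]
  have hFθ : F ((2 / r - 1 : ℝ) : ℂ) = Λ f g := by
    simp only [hF, hθ]
    congr 1 <;> ext x <;> simp [signedCpow_one]
  have hθ0 : 0 ≤ 2 / r - 1 := by rw [sub_nonneg, le_div_iff₀ hr0]; linarith
  have hθ1 : 2 / r - 1 ≤ 1 := by rw [sub_le_iff_le_add, div_le_iff₀ hr0]; linarith
  have key := Complex.HadamardThreeLines.norm_le_interp_of_mem_verticalClosedStrip₀₁' F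
    (z := ((2 / r - 1 : ℝ) : ℂ)) (a := A₂ * (Nf * Ng) ^ (r / 2)) (b := A₁ * (Nf * Ng) ^ r)
    (by simp only [Complex.HadamardThreeLines.verticalClosedStrip, Set.mem_preimage,
          Complex.ofReal_re]; exact ⟨hθ0, hθ1⟩)
    (by
      apply Differentiable.diffContOnCl
      have : F = _ := funext hFe
      rw [this]
      have hd : ∀ c, Differentiable ℂ (fun z => signedCpow (W z) c) := fun c =>
        (differentiable_signedCpow c).comp (by simp only [hW]; fun_prop)
      refine Differentiable.fun_sum fun c _ => Differentiable.fun_sum fun d _ => ?_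
      exact ((hd c).mul (hd d)).mul_const _)
    (by
      refine ⟨∑ c ∈ f.range, ∑ d ∈ g.range, (1 + ‖c‖) ^ r * (1 + ‖d‖) ^ r * ‖L c d‖, ?_⟩
      rintro _ ⟨z, hz, rfl⟩
      simp only [Function.comp, hFe]
      obtain ⟨hz0, hz1⟩ : 0 ≤ z.re ∧ z.re ≤ 1 := hz
      have hp : 0 < (W z).re := by rw [hWre]; positivity
      have hp' : (W z).re ≤ r := by rw [hWre]; nlinarith
      refine (norm_sum_le _ _).trans (Finset.sum_le_sum fun c _ => ?_)
      refine (norm_sum_le _ _).trans (Finset.sum_le_sum fun d _ => ?_)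
      rw [norm_mul, norm_mul]
      gcongr <;> exact norm_signedCpow_le hp hp')
    (by
      intro z hz
      have hz : z.re = 0 := hz
      have hw : (W z).re = r / 2 := by rw [hWre, hz]; ring
      have hp : 0 < (W z).re := by rw [hw]; positivity
      refine (h2 _ _ (signedCpow_zero _) (signedCpow_zero _)).trans (le_of_eq ?_)
      rw [eLpNorm_map_signedCpow _ hp, eLpNorm_map_signedCpow _ hp, hw]
      have : (2 : ℝ≥0∞) * ENNReal.ofReal (r / 2) = ENNReal.ofReal r := by
        rw [show (2 : ℝ≥0∞) = ENNReal.ofReal 2 by simp, ← ENNReal.ofReal_mul (by norm_num)]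
        congr 1; ring
      rw [this, ← ENNReal.toReal_rpow, ← ENNReal.toReal_rpow, ← Real.mul_rpow hNf0 hNg0])
    (by
      intro z hz
      have hz : z.re = 1 := hz
      have hw : (W z).re = r := by rw [hWre, hz]; ring
      have hp : 0 < (W z).re := by rw [hw]; positivity
      refine (h1 _ _ (signedCpow_zero _) (signedCpow_zero _)).trans (le_of_eq ?_)
      rw [eLpNorm_map_signedCpow _ hp, eLpNorm_map_signedCpow _ hp, hw]
      rw [one_mul, ← ENNReal.toReal_rpow, ← ENNReal.toReal_rpow, ← Real.mul_rpow hNf0 hNg0])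
  rw [hFθ, Complex.ofReal_re] at key
  refine key.trans (le_of_eq ?_)
  have hN : 0 ≤ Nf * Ng := mul_nonneg hNf0 hNg0
  rw [Real.mul_rpow hA₂ (by positivity), Real.mul_rpow hA₁ (by positivity), ← Real.rpow_mul hN,
    ← Real.rpow_mul hN, show 1 - (2 / r - 1) = 2 - 2 / r by ring, mul_mul_mul_comm]
  congr 1
  -- The powers of `Nf * Ng` from the two boundary lines add up to 1.
  rw [← Real.rpow_add_of_nonneg hN]
  · rw [show r / 2 * (2 - 2 / r) + r * (2 / r - 1) = 1 by field_simp; ring, Real.rpow_one]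
  · have : 0 ≤ 2 - 2 / r := by linarith
    positivity
  · positivity

theorem integral_norm_mul_norm_le {α : Type*} [MeasurableSpace α] {μ : Measure α} {p r : ℝ≥0∞}
    [hpr : p.HolderConjugate r] {f g : α → ℂ} (hf : MemLp f p μ) (hg : MemLp g r μ) :
    ∫ x, ‖f x‖ * ‖g x‖ ∂μ ≤ (eLpNorm f p μ).toReal * (eLpNorm g r μ).toReal := by
  refine (Real.le_norm_self _).trans ((norm_integral_le_lintegral_norm _).trans ?_)
  rw [← ENNReal.toReal_mul]
  refine ENNReal.toReal_mono (ENNReal.mul_ne_top hf.2.ne hg.2.ne) ?_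
  have := eLpNorm_smul_le_mul_eLpNorm (r := 1) hg.1 hf.1 (p := p) (q := r)
  rw [eLpNorm_one_eq_lintegral_enorm] at this
  refine le_trans (le_of_eq ?_) this
  refine lintegral_congr fun x => ?_
  rw [← norm_mul, norm_norm, ofReal_norm]
  simp

/-- Hölder's inequality for the integral of a product. -/
theorem norm_integral_mul_le {α : Type*} [MeasurableSpace α] {μ : Measure α} {p r : ℝ≥0∞}
    [hpr : p.HolderConjugate r] {f g : α → ℂ} (hf : MemLp f p μ) (hg : MemLp g r μ) :
    ‖∫ x, f x * g x ∂μ‖ ≤ (eLpNorm f p μ).toReal * (eLpNorm g r μ).toReal := by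
  refine (norm_integral_le_integral_norm _).trans ?_
  simp_rw [norm_mul]
  exact integral_norm_mul_norm_le hf hg

/-- Converse Hölder inequality, tested on simple functions. -/
theorem eLpNorm_le_of_forall_simpleFunc {α : Type*} [MeasurableSpace α] {μ : Measure α}
    {p r A : ℝ} (hpr : p.HolderConjugate r) (hA : 0 ≤ A) {w : α → ℂ}
    (hw : MemLp w (ENNReal.ofReal p) μ)
    (h : ∀ g : SimpleFunc α ℂ, MemLp g (ENNReal.ofReal r) μ →
      ‖∫ x, w x * g x ∂μ‖ ≤ A * (eLpNorm g (ENNReal.ofReal r) μ).toReal) :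
    eLpNorm w (ENNReal.ofReal p) μ ≤ ENNReal.ofReal A := by
  have hp0 := hpr.pos
  have hr0 := hpr.symm.pos
  have hp1 := hpr.lt
  have : (ENNReal.ofReal r).HolderConjugate (ENNReal.ofReal p) := hpr.symm.ennrealOfReal
  have : (ENNReal.ofReal p).HolderConjugate (ENNReal.ofReal r) := hpr.ennrealOfReal
  have hr1 : 1 ≤ ENNReal.ofReal r := by
    rw [← ENNReal.ofReal_one]; exact ENNReal.ofReal_le_ofReal hpr.symm.lt.le
  have hint : ∀ g : α → ℂ, MemLp g (ENNReal.ofReal r) μ → Integrable (fun x => w x * g x) μ :=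
    fun g hg => hw.integrable_mul hg
  -- The bound passes from simple functions to all of L^r by density. The a priori membership of `w`
  -- in L^p controls the error.
  have hall : ∀ g : α → ℂ, MemLp g (ENNReal.ofReal r) μ →
      ‖∫ x, w x * g x ∂μ‖ ≤ A * (eLpNorm g (ENNReal.ofReal r) μ).toReal := by
    intro g hg
    set N := (eLpNorm w (ENNReal.ofReal p) μ).toReal
    have hN : 0 ≤ N := ENNReal.toReal_nonneg
    have hε : ∀ ε : ℝ, 0 < ε →
        ‖∫ x, w x * g x ∂μ‖ ≤ A * (eLpNorm g (ENNReal.ofReal r) μ).toReal + ε * (A + N) := by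
      intro ε hε
      obtain ⟨g₀, hg', hg'm⟩ := hg.exists_simpleFunc_eLpNorm_sub_lt ENNReal.ofReal_ne_top
        (ε := ENNReal.ofReal ε) (by simpa using hε)
      have h1 := h g₀ hg'm
      generalize (g₀ : α → ℂ) = g' at *
      have e1 : ∫ x, w x * g x ∂μ = ∫ x, w x * g' x ∂μ + ∫ x, w x * (g - g') x ∂μ := by
        rw [← integral_add (hint _ hg'm) (hint _ (hg.sub hg'm))]
        congr 1 with x
        simp; ring
      have e2 : (eLpNorm (g - g') (ENNReal.ofReal r) μ).toReal ≤ ε :=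
        ENNReal.toReal_le_of_le_ofReal hε.le hg'.le
      have e3 : (eLpNorm g' (ENNReal.ofReal r) μ).toReal ≤
          (eLpNorm g (ENNReal.ofReal r) μ).toReal + ε := by
        have : (g' : α → ℂ) = g - (g - g') := by simp
        rw [this]
        have h1 := eLpNorm_sub_le hg.1 (hg.sub hg'm).1 hr1
        refine (ENNReal.toReal_mono (ENNReal.add_ne_top.2 ⟨hg.2.ne, (hg.sub hg'm).2.ne⟩)
          h1).trans ?_
        rw [ENNReal.toReal_add hg.2.ne (hg.sub hg'm).2.ne]
        gcongr
      rw [e1]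
      refine (norm_add_le _ _).trans ?_
      have h2 := norm_integral_mul_le hw (hg.sub hg'm)
      have h3 := mul_le_mul_of_nonneg_left e3 hA
      have h4 := mul_le_mul_of_nonneg_left e2 hN
      linarith
    clear_value N
    refine le_of_forall_pos_le_add fun ε hε' => ?_
    have hpos : 0 < A + N + 1 := by positivity
    refine (hε (ε / (A + N + 1)) (by positivity)).trans ?_
    gcongr
    rw [div_mul_eq_mul_div, div_le_iff₀ hpos]
    nlinarith
  -- The extremiser in Hölder's inequality: w g = |w|^p and |g|^r = |w|^p. Dividing by the finite
  -- quantity ‖w‖_p^{p-1} gives the bound.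
  set g : α → ℂ := fun x => (starRingEnd ℂ) (w x) * ((‖w x‖ ^ (p - 2) : ℝ) : ℂ) with hg
  have hgn : ∀ x, ‖g x‖ = ‖w x‖ ^ (p - 1) := by
    intro x
    by_cases hx : w x = 0
    · simp [hg, hx, Real.zero_rpow (sub_pos.2 hp1).ne']
    · have h' : (0 : ℝ) < ‖w x‖ := norm_pos_iff.2 hx
      simp only [hg, norm_mul, RCLike.norm_conj, Complex.norm_real, Real.norm_eq_abs]
      rw [abs_of_nonneg (by positivity), show p - 1 = 1 + (p - 2) by ring, Real.rpow_add h',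
        Real.rpow_one]
  have hgm : AEStronglyMeasurable g μ := by
    have h1 : AEMeasurable w μ := hw.1.aemeasurable
    have : AEMeasurable g μ := by
      simp only [hg]
      fun_prop
    exact this.aestronglyMeasurable
  have hpr' : r * (p - 1) = p := by
    have := hpr.symm.sub_one_mul_conj
    have h2 := hpr.sub_one_mul_conj
    linarith
  have hgr : eLpNorm g (ENNReal.ofReal r) μ = eLpNorm w (ENNReal.ofReal p) μ ^ (p - 1) := by
    rw [eLpNorm_congr_norm_ae (g := fun x => ‖w x‖ ^ (p - 1)) (Filter.Eventually.of_forall ?_)]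
    · rw [eLpNorm_norm_rpow _ (by linarith), ← ENNReal.ofReal_mul hr0.le, hpr']
    · intro x
      rw [hgn, Real.norm_eq_abs, abs_of_nonneg (by positivity)]
  have hgL : MemLp g (ENNReal.ofReal r) μ :=
    ⟨hgm, by rw [hgr]; exact ENNReal.rpow_lt_top_of_nonneg (by linarith) hw.2.ne⟩
  have key := hall g hgL
  have hI : ∫ x, w x * g x ∂μ = (((eLpNorm w (ENNReal.ofReal p) μ).toReal ^ p : ℝ) : ℂ) := by
    have e : ∀ x, w x * g x = ((‖w x‖ ^ p : ℝ) : ℂ) := by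
      intro x
      by_cases hx : w x = 0
      · simp [hg, hx, Real.zero_rpow hp0.ne']
      · have h' : (0 : ℝ) < ‖w x‖ := norm_pos_iff.2 hx
        simp only [hg]
        rw [← mul_assoc, Complex.mul_conj', ← Complex.ofReal_pow, ← Complex.ofReal_mul,
          ← Real.rpow_natCast, ← Real.rpow_add h']
        norm_num
    simp_rw [e]
    rw [integral_complex_ofReal]
    congr 1
    have h1 := hw.eLpNorm_eq_integral_rpow_norm (by simpa using hp0) ENNReal.ofReal_ne_top
    rw [ENNReal.toReal_ofReal hp0.le] at h1
    have h2 : 0 ≤ ∫ x, ‖w x‖ ^ p ∂μ := integral_nonneg fun x => by positivity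
    rw [h1, ENNReal.toReal_ofReal (by positivity), ← Real.rpow_mul h2, inv_mul_cancel₀ hp0.ne',
      Real.rpow_one]
  rw [hI, hgr, Complex.norm_real, ← ENNReal.toReal_rpow] at key
  rw [← ENNReal.ofReal_toReal hw.2.ne]
  apply ENNReal.ofReal_le_ofReal
  have hN : 0 ≤ (eLpNorm w (ENNReal.ofReal p) μ).toReal := ENNReal.toReal_nonneg
  generalize (eLpNorm w (ENNReal.ofReal p) μ).toReal = N at *
  rcases hN.eq_or_lt with h0 | h0
  · rwa [← h0]
  · rw [Real.norm_eq_abs, abs_of_nonneg (by positivity),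
      show p = 1 + (p - 1) by ring, Real.rpow_add h0, Real.rpow_one,
      show 1 + (p - 1) - 1 = p - 1 by ring] at key
    exact le_of_mul_le_mul_right key (by positivity)

end Interpolation

/-! ### Convolution with Schwartz kernels and its L^r → L^p bounds -/

section Convolution

open FourierTransform Filter Topology

variable {n : ℕ}

/-- Convolution of a function with a Schwartz kernel. -/
def schwartzConv (K : 𝓢(Eucl n, ℂ)) (h : Eucl n → ℂ) (x : Eucl n) : ℂ := ∫ t, h t * K (x - t)

theorem eLpNorm_comp_sub_left (K : Eucl n → ℂ) (hK : AEStronglyMeasurable K volume)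
    (p : ℝ≥0∞) (x : Eucl n) :
    eLpNorm (fun t => K (x - t)) p volume = eLpNorm K p volume :=
  eLpNorm_comp_measurePreserving hK (Measure.measurePreserving_sub_left volume x)

theorem memLp_comp_sub_left (K : 𝓢(Eucl n, ℂ)) (p : ℝ≥0∞) (x : Eucl n) :
    MemLp (fun t => K (x - t)) p volume :=
  (K.memLp p volume).comp_measurePreserving (Measure.measurePreserving_sub_left volume x)

theorem schwartzConv_eq_convolution (K : 𝓢(Eucl n, ℂ)) (h : Eucl n → ℂ) :
    schwartzConv K h = convolution h K (ContinuousLinearMap.mul ℂ ℂ) volume := by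
  ext x; rfl

theorem integrable_schwartzConv (K : 𝓢(Eucl n, ℂ)) {h : Eucl n → ℂ} (hh : Integrable h) :
    Integrable (schwartzConv K h) := by
  rw [schwartzConv_eq_convolution]
  exact hh.integrable_convolution _ K.integrable

theorem norm_schwartzConv_le_of_memLp (K : 𝓢(Eucl n, ℂ)) {p r : ℝ≥0∞} [hpr : r.HolderConjugate p]
    {h : Eucl n → ℂ} (hh : MemLp h r volume) (x : Eucl n) :
    ‖schwartzConv K h x‖ ≤ (eLpNorm h r volume).toReal * (eLpNorm K p volume).toReal := by
  rw [← eLpNorm_comp_sub_left K K.continuous.aestronglyMeasurable p x]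
  exact norm_integral_mul_le hh (memLp_comp_sub_left K p x)

theorem schwartzConv_sub (K : 𝓢(Eucl n, ℂ)) {p r : ℝ≥0∞} [hpr : r.HolderConjugate p]
    {f g : Eucl n → ℂ} (hf : MemLp f r volume) (hg : MemLp g r volume) (x : Eucl n) :
    schwartzConv K (f - g) x = schwartzConv K f x - schwartzConv K g x := by
  refine Eq.trans ?_ (integral_sub (hf.integrable_mul (memLp_comp_sub_left K p x))
    (hg.integrable_mul (memLp_comp_sub_left K p x)))
  simp [schwartzConv, sub_mul]

/-- An `Lʳ → Lᵖ` bound for a convolution operator extends from a dense class. -/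
theorem eLpNorm_schwartzConv_le_of_dense (K : 𝓢(Eucl n, ℂ)) {p r : ℝ≥0∞}
    [hpr : r.HolderConjugate p] (hr : 1 ≤ r) {A : ℝ≥0} (D : Set (Eucl n → ℂ))
    (hDm : ∀ f ∈ D, MemLp f r volume)
    (hDi : ∀ f ∈ D, AEStronglyMeasurable (schwartzConv K f) volume)
    (hDb : ∀ f ∈ D, eLpNorm (schwartzConv K f) p volume ≤ A * eLpNorm f r volume)
    {h : Eucl n → ℂ} (hh : MemLp h r volume)
    (hD : ∀ ε : ℝ≥0∞, ε ≠ 0 → ∃ f ∈ D, eLpNorm (h - f) r volume < ε) :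
    AEStronglyMeasurable (schwartzConv K h) volume ∧
      eLpNorm (schwartzConv K h) p volume ≤ A * eLpNorm h r volume := by
  have hseq : ∀ k : ℕ, ∃ f ∈ D, eLpNorm (h - f) r volume < ((k : ℝ≥0∞) + 1)⁻¹ := fun k =>
    hD _ (by simp)
  choose f hfD hf using hseq
  have hlim0 : Tendsto (fun k : ℕ => ((k : ℝ≥0∞) + 1)⁻¹) atTop (𝓝 0) := by
    have := (tendsto_add_atTop_iff_nat 1).2 ENNReal.tendsto_inv_nat_nhds_zero
    simpa using this
  have hlim : Tendsto (fun k => eLpNorm (h - f k) r volume) atTop (𝓝 0) :=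
    tendsto_of_tendsto_of_tendsto_of_le_of_le tendsto_const_nhds hlim0 (fun _ => zero_le)
      fun k => (hf k).le
  -- The kernel is itself in L^p, so by Hölder's inequality convergence in L^r forces pointwise
  -- convergence of the convolutions. Fatou's lemma then transports the bound.
  have hpt : ∀ x, Tendsto (fun k => schwartzConv K (f k) x) atTop (𝓝 (schwartzConv K h x)) := by
    intro x
    rw [tendsto_iff_norm_sub_tendsto_zero]
    have h1 : Tendsto (fun k => (eLpNorm (h - f k) r volume).toReal *
        (eLpNorm K p volume).toReal) atTop (𝓝 0) := by
      have := ((ENNReal.tendsto_toReal ENNReal.zero_ne_top).comp hlim).mul_const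
        (eLpNorm K p volume).toReal
      simpa using this
    refine squeeze_zero (fun _ => norm_nonneg _) (fun k => ?_) h1
    rw [norm_sub_rev, ← schwartzConv_sub (p := p) K hh (hDm _ (hfD k)) x]
    exact norm_schwartzConv_le_of_memLp K (hh.sub (hDm _ (hfD k))) x
  refine ⟨aestronglyMeasurable_of_tendsto_ae atTop (fun k => hDi _ (hfD k))
    (Eventually.of_forall hpt), ?_⟩
  refine (Lp.eLpNorm_lim_le_liminf_eLpNorm (fun k => hDi _ (hfD k)) _
    (Eventually.of_forall hpt)).trans ?_
  have hb : ∀ k, eLpNorm (schwartzConv K (f k)) p volume ≤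
      A * (eLpNorm h r volume + eLpNorm (h - f k) r volume) := by
    intro k
    refine (hDb _ (hfD k)).trans ?_
    gcongr
    have : f k = h - (h - f k) := by simp
    conv_lhs => rw [this]
    exact eLpNorm_sub_le hh.1 (hh.sub (hDm _ (hfD k))).1 hr
  have hlim2 : Tendsto (fun k => (A : ℝ≥0∞) * (eLpNorm h r volume + eLpNorm (h - f k) r volume))
      atTop (𝓝 (A * (eLpNorm h r volume + 0))) :=
    ENNReal.Tendsto.const_mul (tendsto_const_nhds.add hlim) (Or.inr ENNReal.coe_ne_top)
  rw [add_zero] at hlim2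
  rw [← hlim2.liminf_eq]
  exact liminf_le_liminf (Eventually.of_forall hb)

/-- For a Schwartz symbol `M`, the operator `𝓕⁻¹ M 𝓕` is convolution with `𝓕⁻¹ M`. -/
theorem schwartzConv_fourierInv (M φ : 𝓢(Eucl n, ℂ)) :
    schwartzConv (𝓕⁻ M) φ = 𝓕⁻ (SchwartzMap.smulLeftCLM ℂ M (𝓕 φ)) := by
  have h := SchwartzMap.convolution_apply (ContinuousLinearMap.mul ℂ ℂ) φ (𝓕⁻ M)
  ext x
  rw [schwartzConv_eq_convolution, ← h x]
  rw [SchwartzMap.convolution]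
  simp only [LinearMap.coe_mk, AddHom.coe_mk, ContinuousLinearMap.comp_apply, fourierCLM_apply,
    fourierInvCLM_apply, fourier_fourierInv_eq]
  congr 2
  ext ξ
  simp [M.hasTemperateGrowth, mul_comm]

theorem fourierInv_even {M : 𝓢(Eucl n, ℂ)} (hM : ∀ ξ, M (-ξ) = M ξ) : 𝓕⁻ M = 𝓕 M := by
  ext x
  rw [SchwartzMap.fourierInv_coe, SchwartzMap.fourier_coe, Real.fourierInv_eq', Real.fourier_eq',
    ← integral_neg_eq_self]
  simp [hM]

theorem fourier_apply_neg (f : 𝓢(Eucl n, ℂ)) (x : Eucl n) : 𝓕 f (-x) = 𝓕⁻ f x := by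
  rw [SchwartzMap.fourierInv_coe, SchwartzMap.fourier_coe, Real.fourierInv_eq_fourier_neg]

/-- A multiplier acts on a distribution through its transpose 𝓕 M 𝓕⁻¹ on test functions. For an even
symbol, the reflection ξ ↦ -ξ identifies this with 𝓕⁻¹ M 𝓕. -/
theorem fourier_mul_fourierInv_even {M : 𝓢(Eucl n, ℂ)} (hM : ∀ ξ, M (-ξ) = M ξ)
    (φ : 𝓢(Eucl n, ℂ)) :
    𝓕 (SchwartzMap.smulLeftCLM ℂ M (𝓕⁻ φ)) = 𝓕⁻ (SchwartzMap.smulLeftCLM ℂ M (𝓕 φ)) := by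
  ext x
  rw [SchwartzMap.fourierInv_coe, SchwartzMap.fourier_coe, Real.fourierInv_eq', Real.fourier_eq',
    ← integral_neg_eq_self]
  congr 1 with ξ
  rw [SchwartzMap.smulLeftCLM_apply_apply M.hasTemperateGrowth,
    SchwartzMap.smulLeftCLM_apply_apply M.hasTemperateGrowth, hM, ← fourier_apply_neg, neg_neg]
  simp

theorem eLpNorm_fourier_two (f : 𝓢(Eucl n, ℂ)) :
    eLpNorm (𝓕 f : 𝓢(Eucl n, ℂ)) 2 volume = eLpNorm f 2 volume := by
  have h := SchwartzMap.norm_fourier_toL2_eq f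
  rw [SchwartzMap.norm_toLp, SchwartzMap.norm_toLp] at h
  exact (ENNReal.toReal_eq_toReal_iff' ((𝓕 f).memLp 2 volume).2.ne (f.memLp 2 volume).2.ne).1 h

theorem eLpNorm_fourierInv_two (f : 𝓢(Eucl n, ℂ)) :
    eLpNorm (𝓕⁻ f : 𝓢(Eucl n, ℂ)) 2 volume = eLpNorm f 2 volume := by
  rw [← eLpNorm_fourier_two, fourier_fourierInv_eq]

/-- `L²` bound of a Fourier multiplier. -/
theorem eLpNorm_schwartzConv_two_le (M : 𝓢(Eucl n, ℂ)) {A : ℝ≥0} (hA : ∀ ξ, ‖M ξ‖ ≤ A)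
    {h : Eucl n → ℂ} (hh : MemLp h 2 volume) :
    eLpNorm (schwartzConv (𝓕⁻ M) h) 2 volume ≤ A * eLpNorm h 2 volume := by
  refine (eLpNorm_schwartzConv_le_of_dense (𝓕⁻ M) (p := 2) (r := 2) (by norm_num)
    (Set.range fun φ : 𝓢(Eucl n, ℂ) => (φ : Eucl n → ℂ)) ?_ ?_ ?_ hh ?_).2
  · rintro _ ⟨φ, rfl⟩
    exact φ.memLp 2 volume
  · rintro _ ⟨φ, rfl⟩
    exact (integrable_schwartzConv _ φ.integrable).1
  · rintro _ ⟨φ, rfl⟩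
    rw [schwartzConv_fourierInv, eLpNorm_fourierInv_two, ← eLpNorm_fourier_two φ]
    refine eLpNorm_le_nnreal_smul_eLpNorm_of_ae_le_mul (Eventually.of_forall fun ξ => ?_) 2
    rw [SchwartzMap.smulLeftCLM_apply_apply M.hasTemperateGrowth, smul_eq_mul, nnnorm_mul]
    gcongr
    exact hA ξ
  · intro ε hε
    have hd := SchwartzMap.denseRange_toLpCLM (E := Eucl n) (F := ℂ) (p := 2) (μ := volume)
      (by norm_num)
    have : Dense (Set.range (SchwartzMap.toLpCLM ℝ ℂ 2 (volume : Measure (Eucl n)))) := hd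
    obtain ⟨_, ⟨φ, rfl⟩, hφ⟩ := EMetric.mem_closure_iff.1 (this (hh.toLp h)) ε (by positivity)
    refine ⟨φ, ⟨φ, rfl⟩, ?_⟩
    rw [SchwartzMap.toLpCLM_apply, SchwartzMap.toLp, Lp.edist_toLp_toLp] at hφ
    exact hφ

/-- Pointwise, |f|^q ≤ ‖f‖_∞^{q-1} |f| almost everywhere. This supplies the a priori membership in
L^p that the converse Hölder inequality asks for. -/
theorem memLp_of_memLp_one_of_memLp_top {α : Type*} [MeasurableSpace α] {μ : Measure α}
    {f : α → ℂ} (h1 : MemLp f 1 μ) (h2 : MemLp f ⊤ μ) {q : ℝ≥0∞} (hq : 1 ≤ q) : MemLp f q μ := by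
  rcases eq_or_ne q ⊤ with rfl | hq'
  · exact h2
  have hq1 : 1 ≤ q.toReal := by
    simpa using ENNReal.toReal_mono hq' hq
  refine ⟨h1.1, (eLpNorm_lt_top_iff_lintegral_rpow_enorm_lt_top
    (zero_lt_one.trans_le hq).ne' hq').2 ?_⟩
  calc ∫⁻ x, ‖f x‖ₑ ^ q.toReal ∂μ ≤ ∫⁻ x, eLpNorm f ⊤ μ ^ (q.toReal - 1) * ‖f x‖ₑ ∂μ := by
        refine lintegral_mono_ae ?_
        rw [eLpNorm_exponent_top]
        filter_upwards [enorm_ae_le_eLpNormEssSup f μ] with x hx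
        calc ‖f x‖ₑ ^ q.toReal = ‖f x‖ₑ ^ ((q.toReal - 1) + 1) := by congr 1; ring
          _ = ‖f x‖ₑ ^ (q.toReal - 1) * ‖f x‖ₑ := by
              rw [ENNReal.rpow_add_of_nonneg _ _ (by linarith) zero_le_one, ENNReal.rpow_one]
          _ ≤ _ := by gcongr
    _ < ⊤ := by
        have hB : eLpNorm f ⊤ μ ^ (q.toReal - 1) < ⊤ :=
          ENNReal.rpow_lt_top_of_nonneg (by linarith) h2.2.ne
        rw [lintegral_const_mul' _ _ hB.ne, ← eLpNorm_one_eq_lintegral_enorm]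
        exact ENNReal.mul_lt_top hB h1.2

theorem simpleFunc_map_eq_sum {α : Type*} [MeasurableSpace α] (f : SimpleFunc α ℂ) (G : ℂ → ℂ)
    (x : α) : f.map G x = ∑ c ∈ f.range, G c * (f ⁻¹' {c}).indicator 1 x := by
  rw [Finset.sum_eq_single (f x)]
  · simp
  · intro c _ hc
    rw [Set.indicator_of_notMem (by simpa using hc.symm), mul_zero]
  · intro h
    exact absurd (f.mem_range_self x) h

theorem schwartzConv_map (K : 𝓢(Eucl n, ℂ)) (f : SimpleFunc (Eucl n) ℂ) (G : ℂ → ℂ) (x : Eucl n) :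
    schwartzConv K (f.map G) x =
      ∑ c ∈ f.range, G c * schwartzConv K ((f ⁻¹' {c}).indicator 1) x := by
  unfold schwartzConv
  simp_rw [← integral_const_mul]
  rw [← integral_finsetSum]
  · congr 1 with t
    rw [Finset.sum_eq_single (f t)]
    · simp
    · intro c _ hc
      rw [Set.indicator_of_notMem (by simpa using hc.symm)]
      simp
    · intro h
      exact absurd (f.mem_range_self t) h
  · intro c _
    refine Integrable.const_mul ?_ _
    have := ((memLp_one_iff_integrable.1 (memLp_comp_sub_left K 1 x)).indicator
      (f.measurableSet_preimage {c}))
    refine this.congr (Eventually.of_forall fun t => ?_)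
    by_cases ht : t ∈ f ⁻¹' {c}
    · simp [Set.indicator_of_mem ht]
    · simp [Set.indicator_of_notMem ht]

/-- `Lʳ → Lᵖ` bound of a Fourier multiplier on simple functions, `1 < r ≤ 2`. -/
theorem eLpNorm_schwartzConv_simpleFunc_le (M : 𝓢(Eucl n, ℂ)) {A₁ A₂ : ℝ≥0} {p r : ℝ}
    (hA₂ : ∀ ξ, ‖M ξ‖ ≤ A₂) (hA₁ : ∀ x, ‖(𝓕⁻ M : 𝓢(Eucl n, ℂ)) x‖ ≤ A₁)
    (hpr : p.HolderConjugate r) (hr : r ≤ 2) (f : SimpleFunc (Eucl n) ℂ)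
    (hf : MemLp f (ENNReal.ofReal r) volume) :
    eLpNorm (schwartzConv (𝓕⁻ M) f) (ENNReal.ofReal p) volume ≤
      (A₂ ^ (2 - 2 / r) * A₁ ^ (2 / r - 1) : ℝ≥0) * eLpNorm f (ENNReal.ofReal r) volume := by
  have hr0 : 0 < r := hpr.symm.pos
  have hp0 : 0 < p := hpr.pos
  have hsupp : ∀ f : SimpleFunc (Eucl n) ℂ, MemLp f (ENNReal.ofReal r) volume →
      ∀ G : ℂ → ℂ, G 0 = 0 → ∀ q, MemLp (f.map G) q volume := by
    intro f hf G hG q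
    have := (SimpleFunc.memLp_iff_finMeasSupp (by simpa using hr0) ENNReal.ofReal_ne_top).1 hf
    exact SimpleFunc.memLp_of_finite_measure_preimage q (SimpleFunc.finMeasSupp_iff.1 (this.map hG))
  have hid : ∀ f : SimpleFunc (Eucl n) ℂ, f.map id = f := fun f => by ext; simp
  have hconv1 : ∀ (h : Eucl n → ℂ), MemLp h 1 volume → eLpNorm (schwartzConv (𝓕⁻ M) h) ⊤ volume ≤
      A₁ * eLpNorm h 1 volume := by
    intro h hh
    refine eLpNorm_exponent_top (μ := volume) (f := schwartzConv (𝓕⁻ M) h) ▸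
      eLpNormEssSup_le_of_ae_enorm_bound (Eventually.of_forall fun x => ?_)
    refine (enorm_integral_le_lintegral_enorm _).trans ?_
    rw [eLpNorm_one_eq_lintegral_enorm, ← lintegral_const_mul' _ _ ENNReal.coe_ne_top]
    refine lintegral_mono fun t => ?_
    rw [enorm_mul, mul_comm]
    gcongr
    rw [← ofReal_norm, ← ENNReal.ofReal_coe_nnreal]
    exact ENNReal.ofReal_le_ofReal (hA₁ _)
  have hfi : MemLp f 1 volume := by simpa [hid] using hsupp f hf id rfl 1
  have hconvLp : ∀ h : Eucl n → ℂ, MemLp h 1 volume → ∀ q, 1 ≤ q →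
      MemLp (schwartzConv (𝓕⁻ M) h) q volume := by
    intro h hh q hq
    have h1 := integrable_schwartzConv (𝓕⁻ M) (memLp_one_iff_integrable.1 hh)
    have h2 : MemLp (schwartzConv (𝓕⁻ M) h) ⊤ volume :=
      ⟨h1.1, (hconv1 h hh).trans_lt (ENNReal.mul_lt_top ENNReal.coe_lt_top hh.2)⟩
    exact memLp_of_memLp_one_of_memLp_top (memLp_one_iff_integrable.2 h1) h2 hq
  have key := eLpNorm_le_of_forall_simpleFunc hpr (w := schwartzConv (𝓕⁻ M) f) (μ := volume)
    (A := A₂ ^ (2 - 2 / r) * A₁ ^ (2 / r - 1) * (eLpNorm f (ENNReal.ofReal r) volume).toReal)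
    (by positivity) (hconvLp f hfi _ (by
      rw [← ENNReal.ofReal_one]; exact ENNReal.ofReal_le_ofReal hpr.lt.le)) ?_
  · refine key.trans (le_of_eq ?_)
    rw [ENNReal.ofReal_mul (by positivity), ENNReal.ofReal_toReal hf.2.ne]
    congr 1
    rw [← ENNReal.ofReal_coe_nnreal]
    congr 1
  · intro g hg
    rw [mul_assoc]
    refine norm_le_interp_simpleFunc (μ := volume) (ν := volume)
      (fun f g => ∫ x, schwartzConv (𝓕⁻ M) f x * g x) f g
      (fun c d => ∫ x, schwartzConv (𝓕⁻ M) ((f ⁻¹' {c}).indicator 1) x *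
        (g ⁻¹' {d}).indicator 1 x) A₁.2 A₂.2 hpr.symm.lt.le hr ?_ ?_ ?_
    · intro G H hG hH
      have hz : ∀ f : SimpleFunc (Eucl n) ℂ, MemLp f (ENNReal.ofReal r) volume → ∀ c, c ≠ 0 →
          MemLp ((f ⁻¹' {c}).indicator (1 : Eucl n → ℂ)) 1 volume := by
        intro f hf c hc
        have := (SimpleFunc.memLp_iff_finMeasSupp (by simpa using hr0) ENNReal.ofReal_ne_top).1 hf
        exact memLp_indicator_const 1 (f.measurableSet_preimage {c}) (1 : ℂ)
          (Or.inr (SimpleFunc.finMeasSupp_iff.1 this c hc).ne)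
      have hint : ∀ c d, Integrable (fun x => G c * H d *
          (schwartzConv (𝓕⁻ M) ((f ⁻¹' {c}).indicator 1) x * (g ⁻¹' {d}).indicator 1 x)) := by
        intro c d
        -- The level sets over 0 may have infinite measure. Their terms vanish because `G 0 = 0` and
        -- `H 0 = 0`.
        by_cases hc : c = 0
        · simp [hc, hG]
        by_cases hd : d = 0
        · simp [hd, hH]
        refine Integrable.const_mul ?_ _
        exact (hconvLp _ (hz f hf c hc) ⊤ le_top).integrable_mul (hz g hg d hd)
      simp_rw [← integral_const_mul]
      have h3 : ∀ c ∈ f.range, ∑ d ∈ g.range, ∫ x, G c * H d *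
          (schwartzConv (𝓕⁻ M) ((f ⁻¹' {c}).indicator 1) x * (g ⁻¹' {d}).indicator 1 x) =
          ∫ x, ∑ d ∈ g.range, G c * H d *
          (schwartzConv (𝓕⁻ M) ((f ⁻¹' {c}).indicator 1) x * (g ⁻¹' {d}).indicator 1 x) :=
        fun c _ => (integral_finsetSum _ fun d _ => hint c d).symm
      rw [Finset.sum_congr rfl h3, ← integral_finsetSum _
        fun c _ => integrable_finsetSum _ fun d _ => hint c d]
      congr 1 with x
      rw [schwartzConv_map, simpleFunc_map_eq_sum, Finset.sum_mul_sum]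
      refine Finset.sum_congr rfl fun c _ => Finset.sum_congr rfl fun d _ => ?_
      ring
    · intro G H hG hH
      have h1 := hsupp f hf G hG 1
      have h2 := hsupp g hg H hH 1
      refine (norm_integral_mul_le (p := ⊤) (r := 1) (hconvLp _ h1 ⊤ le_top) h2).trans ?_
      rw [← mul_assoc]
      gcongr
      have := ENNReal.toReal_mono (ENNReal.mul_ne_top ENNReal.coe_ne_top h1.2.ne) (hconv1 _ h1)
      simpa using this
    · intro G H hG hH
      have h1 := hsupp f hf G hG 2
      have h2 := hsupp g hg H hH 2
      refine (norm_integral_mul_le (p := 2) (r := 2)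
        (hconvLp _ (hsupp f hf G hG 1) 2 (by norm_num)) h2).trans ?_
      rw [← mul_assoc]
      gcongr
      have := ENNReal.toReal_mono (ENNReal.mul_ne_top ENNReal.coe_ne_top h1.2.ne)
        (eLpNorm_schwartzConv_two_le M hA₂ h1)
      simpa using this

end Convolution

/-! ### Fourier multipliers from L^{p'} to L^p on tempered distributions -/

section Multiplier

open FourierTransform Filter Topology

variable {n : ℕ}

theorem delta_nonneg {p : ℝ≥0∞} (hp : 2 ≤ p) : 0 ≤ delta p := by
  unfold delta
  have := ENNReal.toReal_mono (by simp) (ENNReal.inv_le_inv.2 hp)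
  simp at this
  simp
  exact this

/-- `L^{p'} → Lᵖ` bound of a Fourier multiplier, `2 ≤ p ≤ ∞`. -/
theorem eLpNorm_schwartzConv_le (M : 𝓢(Eucl n, ℂ)) {A₁ A₂ : ℝ≥0} {p p' : ℝ≥0∞}
    (hA₂ : ∀ ξ, ‖M ξ‖ ≤ A₂) (hA₁ : ∀ x, ‖(𝓕⁻ M : 𝓢(Eucl n, ℂ)) x‖ ≤ A₁)
    (hp : 2 ≤ p) (hpp : p⁻¹ + p'⁻¹ = 1) {h : Eucl n → ℂ} (hh : MemLp h p' volume) :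
    AEStronglyMeasurable (schwartzConv (𝓕⁻ M) h) volume ∧
    eLpNorm (schwartzConv (𝓕⁻ M) h) p volume ≤
      (A₂ ^ (1 - 2 * delta p) * A₁ ^ (2 * delta p) : ℝ≥0) * eLpNorm h p' volume := by
  -- The endpoint p = ∞, p' = 1 is the sup bound on the kernel. The duality argument for simple
  -- functions covers finite p only.
  rcases eq_or_ne p ⊤ with rfl | hpt
  · have hp1 : p' = 1 := by simpa using hpp
    subst hp1
    refine ⟨(integrable_schwartzConv _ (memLp_one_iff_integrable.1 hh)).1, ?_⟩
    have hd : delta ⊤ = 1 / 2 := by simp [delta]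
    rw [hd]
    norm_num
    refine eLpNormEssSup_le_of_ae_enorm_bound (Eventually.of_forall fun x => ?_)
    refine (enorm_integral_le_lintegral_enorm _).trans ?_
    rw [eLpNorm_one_eq_lintegral_enorm, ← lintegral_const_mul' _ _ ENNReal.coe_ne_top]
    refine lintegral_mono fun t => ?_
    rw [enorm_mul, mul_comm]
    gcongr
    rw [← ofReal_norm, ← ENNReal.ofReal_coe_nnreal]
    exact ENNReal.ofReal_le_ofReal (hA₁ _)
  · have hp0 : p ≠ 0 := (zero_lt_two.trans_le hp).ne'
    have hpc : p.HolderConjugate p' := ⟨by simpa using hpp⟩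
    have hpc' : p'.HolderConjugate p := hpc.symm
    have h2 : 2 ≤ p.toReal := by simpa using ENNReal.toReal_mono hpt hp
    have hp't : p' ≠ ⊤ := by
      rintro rfl
      have : p = 1 := by simpa using hpp
      rw [this] at h2
      norm_num at h2
    have hpr : p.toReal.HolderConjugate p'.toReal := by
      rw [Real.holderConjugate_iff]
      refine ⟨by linarith, ?_⟩
      rw [← ENNReal.toReal_inv, ← ENNReal.toReal_inv, ← ENNReal.toReal_add, hpp]
      · simp
      · simpa using hp0
      · intro h
        rw [h] at hpp
        simp at hpp
    have hr0 := hpr.symm.pos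
    have hinv := hpr.inv_add_inv_eq_one
    have hr2 : p'.toReal ≤ 2 := by
      have : p.toReal⁻¹ ≤ 2⁻¹ := inv_anti₀ (by norm_num) h2
      have h3 : (2 : ℝ)⁻¹ ≤ p'.toReal⁻¹ := by linarith
      exact (inv_le_inv₀ (by norm_num) hr0).1 h3
    have hδ : delta p = 1 / 2 - p.toReal⁻¹ := by rw [delta, ENNReal.toReal_inv]
    have e1 : 1 - 2 * delta p = 2 - 2 / p'.toReal := by
      rw [hδ, div_eq_mul_inv 2 p'.toReal]; linarith
    have e2 : 2 * delta p = 2 / p'.toReal - 1 := by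
      rw [hδ, div_eq_mul_inv 2 p'.toReal]; linarith
    rw [e1, e2]
    have hr1 : 1 ≤ p' := by
      rw [← ENNReal.ofReal_toReal hp't, ← ENNReal.ofReal_one]
      exact ENNReal.ofReal_le_ofReal hpr.symm.lt.le
    refine eLpNorm_schwartzConv_le_of_dense (𝓕⁻ M) hr1
      {f | ∃ g : SimpleFunc (Eucl n) ℂ, MemLp g p' volume ∧ f = g} ?_ ?_ ?_ hh ?_
    · rintro _ ⟨g, hg, rfl⟩
      exact hg
    · rintro _ ⟨g, hg, rfl⟩
      have : MemLp g 1 volume := (SimpleFunc.memLp_iff_finMeasSupp one_ne_zero (by simp)).2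
        ((SimpleFunc.memLp_iff_finMeasSupp (zero_lt_one.trans_le hr1).ne' hp't).1 hg)
      exact (integrable_schwartzConv _ (memLp_one_iff_integrable.1 this)).1
    · rintro _ ⟨g, hg, rfl⟩
      have := eLpNorm_schwartzConv_simpleFunc_le M hA₂ hA₁ hpr hr2 g
        (by rwa [ENNReal.ofReal_toReal hp't])
      rwa [ENNReal.ofReal_toReal hp't, ENNReal.ofReal_toReal hpt] at this
    · intro ε hε
      obtain ⟨g, hg, hgm⟩ := hh.exists_simpleFunc_eLpNorm_sub_lt hp't hε
      exact ⟨g, ⟨g, hgm, rfl⟩, hg⟩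

/-- Fubini's theorem: convolution with an even kernel is its own transpose. Absolute integrability
comes from Hölder's inequality in `t`, uniformly in `x`, and from integrability of `φ`. -/
theorem integral_mul_schwartzConv {K φ : 𝓢(Eucl n, ℂ)} (hK : ∀ x, K (-x) = K x) {p p' : ℝ≥0∞}
    [hpp : p'.HolderConjugate p] {h : Eucl n → ℂ} (hh : MemLp h p' volume) :
    ∫ x, φ x * schwartzConv K h x = ∫ t, schwartzConv K φ t * h t := by
  unfold schwartzConv
  simp_rw [← integral_const_mul, ← integral_mul_const]
  rw [integral_integral_swap]
  · congr 1 with t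
    congr 1 with x
    rw [← hK (x - t), neg_sub]
    ring
  · have hm : AEStronglyMeasurable (Function.uncurry fun x t => φ x * (h t * K (x - t)))
        ((volume : Measure (Eucl n)).prod volume) := by
      refine (φ.continuous.aestronglyMeasurable.comp_fst).mul (hh.1.comp_snd.mul ?_)
      exact (K.continuous.comp (continuous_fst.sub continuous_snd)).aestronglyMeasurable
    refine (integrable_prod_iff hm).2 ⟨Eventually.of_forall fun x => ?_, ?_⟩
    · exact (hh.integrable_mul (memLp_comp_sub_left K p x)).const_mul (φ x)
    · refine Integrable.mono' (g := fun x => ‖φ x‖ * ((eLpNorm h p' volume).toReal *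
        (eLpNorm K p volume).toReal)) (φ.integrable.norm.mul_const _) ?_ ?_
      · exact hm.norm.integral_prod_right'
      · refine Eventually.of_forall fun x => ?_
        rw [Real.norm_of_nonneg (by positivity)]
        simp only [Function.uncurry, norm_mul]
        rw [integral_const_mul]
        gcongr
        rw [← eLpNorm_comp_sub_left K K.continuous.aestronglyMeasurable p x]
        exact integral_norm_mul_norm_le hh (memLp_comp_sub_left K p x)

/-- Multipliers with smooth, even, compactly supported symbols, between spaces of distributions
given by `Lebesgue` functions. -/
theorem distLpNorm_fourierMultiplier_le (M : 𝓢(Eucl n, ℂ)) (hM : ∀ ξ, M (-ξ) = M ξ) {A₁ A₂ : ℝ≥0}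
    {p p' : ℝ≥0∞} (hA₂ : ∀ ξ, ‖M ξ‖ ≤ A₂) (hA₁ : ∀ x, ‖(𝓕⁻ M : 𝓢(Eucl n, ℂ)) x‖ ≤ A₁)
    (hA₁0 : A₁ ≠ 0) (hA₂0 : A₂ ≠ 0)
    (hp : 2 ≤ p) (hpp : p⁻¹ + p'⁻¹ = 1) (u : 𝓢'(Eucl n, ℂ)) :
    distLpNorm p (TemperedDistribution.fourierMultiplierCLM ℂ M u) ≤
      (A₂ ^ (1 - 2 * delta p) * A₁ ^ (2 * delta p) : ℝ≥0) * distLpNorm p' u := by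
  -- A nonzero constant is needed to move it inside the infima: when `u` has no representative in
  -- L^{p'} the infimum is ∞, and 0 · ∞ would be 0.
  have hA : (A₂ ^ (1 - 2 * delta p) * A₁ ^ (2 * delta p) : ℝ≥0) ≠ 0 := by positivity
  unfold distLpNorm
  rw [ENNReal.mul_iInf_of_ne (by simpa using hA) ENNReal.coe_ne_top]
  refine le_iInf fun h => ?_
  rw [ENNReal.mul_iInf_of_ne (by simpa using hA) ENNReal.coe_ne_top]
  refine le_iInf fun hh => ?_
  rw [ENNReal.mul_iInf_of_ne (by simpa using hA) ENNReal.coe_ne_top]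
  refine le_iInf fun hu => ?_
  obtain ⟨hm, hb⟩ := eLpNorm_schwartzConv_le M hA₂ hA₁ hp hpp hh
  refine iInf_le_of_le (schwartzConv (𝓕⁻ M) h) (iInf_le_of_le
    ⟨hm, hb.trans_lt (ENNReal.mul_lt_top ENNReal.coe_lt_top hh.2)⟩ (iInf_le_of_le ?_ hb))
  intro φ
  have : p.HolderConjugate p' := ⟨by simpa using hpp⟩
  have : p'.HolderConjugate p := this.symm
  have hK : ∀ x, (𝓕⁻ M : 𝓢(Eucl n, ℂ)) (-x) = (𝓕⁻ M : 𝓢(Eucl n, ℂ)) x := by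
    intro x
    rw [← fourier_apply_neg M x, fourierInv_even hM]
  rw [TemperedDistribution.fourierMultiplierCLM_apply_apply, hu, integral_mul_schwartzConv (p := p) hK hh,
    fourier_mul_fourierInv_even hM, ← schwartzConv_fourierInv]

end Multiplier

/-! ### The rescaled phase: monotone gradient and integration by parts -/

section Phase

open Filter Topology
open scoped ContDiff

variable {n : ℕ}

/-- On the support the quotient is a quotient of smooth functions with nonzero denominator. Off the
closed set `S` the numerator vanishes in a neighbourhood, whatever `u` does there. -/
theorem contDiff_div_of_support {X : Type*} [NormedAddCommGroup X] [NormedSpace ℝ X]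
    {A : X → ℂ} {u : X → ℝ} {S U : Set X} (hA : ContDiff ℝ ∞ A) (hS : IsClosed S)
    (hAS : ∀ x ∉ S, A x = 0) (hSU : S ⊆ U) (hU : IsOpen U) (hu : ContDiffOn ℝ ∞ u U)
    (hu0 : ∀ x ∈ U, u x ≠ 0) : ContDiff ℝ ∞ (fun x => A x / (u x : ℂ)) := by
  rw [contDiff_iff_contDiffAt]
  intro x
  by_cases hx : x ∈ S
  · have h1 : ContDiffAt ℝ ∞ (fun x => (((u x)⁻¹ : ℝ) : ℂ)) x :=
      Complex.ofRealCLM.contDiff.contDiffAt.comp x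
        ((hu.contDiffAt (hU.mem_nhds (hSU hx))).inv (hu0 x (hSU hx)))
    simpa [div_eq_mul_inv] using hA.contDiffAt.mul h1
  · refine (contDiffAt_const (c := (0 : ℂ))).congr_of_eventuallyEq ?_
    filter_upwards [hS.isOpen_compl.mem_nhds hx] with y hy
    simp [hAS y hy]

/-- Points `(τ, r, e, ξ)`: a parameter `τ`, a displacement `r • e` and a frequency `ξ`. -/
abbrev PhaseSpace (n : ℕ) : Type := ℝ × ℝ × Eucl n × Eucl n

/-- The normalised symbol `√((1 - τ)² + τ² |ζ|⁴)`. -/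
def scaledOmega (τ : ℝ) (ζ : Eucl n) : ℝ := Real.sqrt ((1 - τ) ^ 2 + τ ^ 2 * (‖ζ‖ ^ 2) ^ 2)

theorem scaledOmega_radicand_pos (τ : ℝ) {ζ : Eucl n} (h : ζ ≠ 0) :
    0 < (1 - τ) ^ 2 + τ ^ 2 * (‖ζ‖ ^ 2) ^ 2 := by
  have h' : 0 < ‖ζ‖ := norm_pos_iff.2 h
  rcases eq_or_ne τ 0 with rfl | hτ
  · norm_num
  · positivity

theorem scaledOmega_pos (τ : ℝ) {ζ : Eucl n} (h : ζ ≠ 0) : 0 < scaledOmega τ ζ :=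
  Real.sqrt_pos.2 (scaledOmega_radicand_pos τ h)

theorem scaledOmega_sq (τ : ℝ) (ζ : Eucl n) :
    scaledOmega τ ζ ^ 2 = (1 - τ) ^ 2 + τ ^ 2 * (‖ζ‖ ^ 2) ^ 2 :=
  Real.sq_sqrt (by positivity)

/-- `scaledOmega` has gradient `τ² gradCoeff τ ζ • ζ`. -/
def gradCoeff (τ : ℝ) (ζ : Eucl n) : ℝ := 2 * ‖ζ‖ ^ 2 / scaledOmega τ ζ

/-- The quotient of `gradCoeff τ a - gradCoeff τ b` by `|a|² - |b|²`. -/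
def gradCoeffSlope (τ : ℝ) (a b : Eucl n) : ℝ :=
  2 * (1 - τ) ^ 2 * (‖a‖ ^ 2 + ‖b‖ ^ 2) / (scaledOmega τ a * scaledOmega τ b *
    (‖a‖ ^ 2 * scaledOmega τ b + ‖b‖ ^ 2 * scaledOmega τ a))

/-- Rationalise with the conjugate factor |a|²σ(b) + |b|²σ(a): in |a|⁴σ(b)² - |b|⁴σ(a)² the τ² terms
cancel, leaving (1 - τ)²(|a|⁴ - |b|⁴). The resulting slope is smooth and nonnegative, also on the
diagonal. -/
theorem gradCoeff_sub (τ : ℝ) {a b : Eucl n} (ha : a ≠ 0) (hb : b ≠ 0) :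
    gradCoeff τ a - gradCoeff τ b = gradCoeffSlope τ a b * (‖a‖ ^ 2 - ‖b‖ ^ 2) := by
  have ha' := scaledOmega_pos τ ha
  have hb' := scaledOmega_pos τ hb
  have hsa := scaledOmega_sq τ a
  have hsb := scaledOmega_sq τ b
  have h1 : 0 < ‖a‖ ^ 2 := by positivity
  have h2 : 0 < ‖b‖ ^ 2 := by positivity
  unfold gradCoeff gradCoeffSlope
  generalize scaledOmega τ a = sa at *
  generalize scaledOmega τ b = sb at *
  generalize ‖a‖ ^ 2 = ra at *
  generalize ‖b‖ ^ 2 = rb at *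
  have h3 : ra * sb + rb * sa ≠ 0 := by positivity
  rw [div_sub_div _ _ ha'.ne' hb'.ne', div_mul_eq_mul_div, div_eq_div_iff (by positivity)
    (by positivity)]
  have : (2 * ra * sb - sa * (2 * rb)) * (ra * sb + rb * sa) =
      2 * (1 - τ) ^ 2 * (ra + rb) * (ra - rb) := by
    linear_combination 2 * ra ^ 2 * hsb - 2 * rb ^ 2 * hsa
  linear_combination sa * sb * this

/-- The derivative of the phase increment along the displacement, divided by the length of the
displacement. -/
def phaseSlope (x : PhaseSpace n) : ℝ :=
  (gradCoeff x.1 (x.2.2.2 + x.2.1 • x.2.2.1) + gradCoeff x.1 x.2.2.2) / 2 +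
  gradCoeffSlope x.1 (x.2.2.2 + x.2.1 • x.2.2.1) x.2.2.2 *
    inner ℝ (x.2.2.2 + x.2.1 • x.2.2.1 + x.2.2.2) x.2.2.1 ^ 2 / 2

/-- With a = ξ + r e, b = ξ and g = `gradCoeff τ`, write g(a)a - g(b)b as half of (g(a) + g(b))(a -
b) plus half of (g(a) - g(b))(a + b). Both terms contain a factor r, since |a|² - |b|² = r⟨a + b,
e⟩. Dividing it out explicitly keeps `phaseSlope` smooth across r = 0. -/
theorem mul_phaseSlope (τ r : ℝ) {e ξ : Eucl n} (he : ‖e‖ = 1) (ha : ξ + r • e ≠ 0) (hb : ξ ≠ 0) :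
    r * phaseSlope (τ, r, e, ξ) =
      gradCoeff τ (ξ + r • e) * inner ℝ (ξ + r • e) e - gradCoeff τ ξ * inner ℝ ξ e := by
  have h := gradCoeff_sub τ ha hb
  have hee : inner ℝ e e = (1 : ℝ) := by rw [real_inner_self_eq_norm_sq, he]; norm_num
  have hn : ‖ξ + r • e‖ ^ 2 - ‖ξ‖ ^ 2 = r * (2 * inner ℝ ξ e + r) := by
    rw [norm_add_sq_real, norm_smul, he, inner_smul_right]
    simp
    ring
  rw [hn] at h
  simp only [phaseSlope, inner_add_left, inner_smul_left, hee]
  simp only [conj_trivial]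
  linear_combination -h * (2 * inner ℝ ξ e + r) / 2

/-- Points where both frequencies are nonzero. -/
def regularSet (n : ℕ) : Set (PhaseSpace n) := {x | x.2.2.2 ≠ 0 ∧ x.2.2.2 + x.2.1 • x.2.2.1 ≠ 0}

/-- Points where both frequencies lie in a fixed annulus. -/
def annularSet (n : ℕ) : Set (PhaseSpace n) :=
  {x | (1 / 4 ≤ ‖x.2.2.2‖ ∧ ‖x.2.2.2‖ ≤ 4) ∧
    (1 / 4 ≤ ‖x.2.2.2 + x.2.1 • x.2.2.1‖ ∧ ‖x.2.2.2 + x.2.1 • x.2.2.1‖ ≤ 4)}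

theorem isOpen_regularSet : IsOpen (regularSet n) :=
  (isOpen_ne_fun (by fun_prop) (by fun_prop)).inter (isOpen_ne_fun (by fun_prop) (by fun_prop))

theorem isClosed_annularSet : IsClosed (annularSet n) := by
  simp only [annularSet, Set.ofPred_and]
  refine ((isClosed_le ?_ ?_).inter (isClosed_le ?_ ?_)).inter
    ((isClosed_le ?_ ?_).inter (isClosed_le ?_ ?_)) <;> fun_prop

theorem annularSet_subset : annularSet n ⊆ regularSet n := by
  rintro x ⟨⟨h1, -⟩, h2, -⟩
  exact ⟨norm_pos_iff.1 (by linarith), norm_pos_iff.1 (by linarith)⟩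

theorem contDiffAt_scaledOmega {X : Type*} [NormedAddCommGroup X] [NormedSpace ℝ X]
    {f : X → ℝ} {g : X → Eucl n} {x : X} (hf : ContDiffAt ℝ ∞ f x) (hg : ContDiffAt ℝ ∞ g x)
    (h : 0 < (1 - f x) ^ 2 + f x ^ 2 * (‖g x‖ ^ 2) ^ 2) :
    ContDiffAt ℝ ∞ (fun x => scaledOmega (f x) (g x)) x := by
  unfold scaledOmega
  refine ContDiffAt.sqrt ?_ h.ne'
  have := hg.norm_sq ℝ
  fun_prop

theorem contDiffOn_phaseSlope : ContDiffOn ℝ ∞ (phaseSlope (n := n)) (regularSet n) := by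
  rintro x ⟨hb, ha⟩
  refine ContDiffAt.contDiffWithinAt ?_
  have hA : ContDiffAt ℝ ∞ (fun x : PhaseSpace n => x.2.2.2 + x.2.1 • x.2.2.1) x := by fun_prop
  have hB : ContDiffAt ℝ ∞ (fun x : PhaseSpace n => x.2.2.2) x := by fun_prop
  have hT : ContDiffAt ℝ ∞ (fun x : PhaseSpace n => x.1) x := by fun_prop
  have hE : ContDiffAt ℝ ∞ (fun x : PhaseSpace n => x.2.2.1) x := by fun_prop
  have sA := contDiffAt_scaledOmega hT hA (scaledOmega_radicand_pos _ ha)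
  have sB := contDiffAt_scaledOmega hT hB (scaledOmega_radicand_pos _ hb)
  have nA := hA.norm_sq ℝ
  have nB := hB.norm_sq ℝ
  have pA := scaledOmega_pos x.1 ha
  have pB := scaledOmega_pos x.1 hb
  have pa : 0 < ‖x.2.2.2 + x.2.1 • x.2.2.1‖ := norm_pos_iff.2 ha
  have pb : 0 < ‖x.2.2.2‖ := norm_pos_iff.2 hb
  unfold phaseSlope gradCoeff gradCoeffSlope
  have i1 := (hA.add hB).inner ℝ hE
  refine ContDiffAt.add (ContDiffAt.div_const (ContDiffAt.add ?_ ?_) _)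
    (ContDiffAt.div_const (ContDiffAt.mul ?_ (i1.pow 2)) _)
  · exact (contDiffAt_const.mul nA).div sA pA.ne'
  · exact (contDiffAt_const.mul nB).div sB pB.ne'
  · refine ContDiffAt.div ?_ ?_ (by positivity)
    · exact (contDiffAt_const.mul ((contDiffAt_const.sub hT).pow 2)).mul (nA.add nB)
    · exact (sA.mul sB).mul ((nA.mul sB).add (nB.mul sA))

/-- Strict monotonicity of the gradient: the averaged coefficient is positive and the slope term is
nonnegative. It holds for every τ, including 0 and 1, and takes the place of a Hessian condition. -/
theorem phaseSlope_pos {x : PhaseSpace n} (hx : x ∈ regularSet n) : 0 < phaseSlope x := by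
  obtain ⟨hb, ha⟩ := hx
  have pA := scaledOmega_pos x.1 ha
  have pB := scaledOmega_pos x.1 hb
  have pa : 0 < ‖x.2.2.2 + x.2.1 • x.2.2.1‖ := norm_pos_iff.2 ha
  have pb : 0 < ‖x.2.2.2‖ := norm_pos_iff.2 hb
  unfold phaseSlope gradCoeff gradCoeffSlope
  positivity

/-- The derivative in the frequency variable along the displacement. -/
def dirDeriv (A : PhaseSpace n → ℂ) (x : PhaseSpace n) : ℂ := fderiv ℝ A x (0, 0, 0, x.2.2.1)

/-- One integration by parts, as an operation on amplitudes. -/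
def ibpStep (A : PhaseSpace n → ℂ) : PhaseSpace n → ℂ :=
  dirDeriv fun x => A x / (phaseSlope x : ℂ)

theorem contDiff_div_phaseSlope {A : PhaseSpace n → ℂ} (hA : ContDiff ℝ ∞ A)
    (hA0 : ∀ x ∉ annularSet n, A x = 0) :
    ContDiff ℝ ∞ (fun x => A x / (phaseSlope x : ℂ)) :=
  contDiff_div_of_support hA isClosed_annularSet hA0 annularSet_subset isOpen_regularSet
    contDiffOn_phaseSlope fun _ hx => (phaseSlope_pos hx).ne'

theorem contDiff_ibpStep {A : PhaseSpace n → ℂ} (hA : ContDiff ℝ ∞ A)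
    (hA0 : ∀ x ∉ annularSet n, A x = 0) : ContDiff ℝ ∞ (ibpStep A) := by
  have h := (contDiff_div_phaseSlope hA hA0).fderiv_right (m := ∞) (by simp)
  unfold ibpStep dirDeriv
  exact h.clm_apply (by fun_prop)

theorem ibpStep_eq_zero {A : PhaseSpace n → ℂ} (hA0 : ∀ x ∉ annularSet n, A x = 0) :
    ∀ x ∉ annularSet n, ibpStep A x = 0 := by
  intro x hx
  have : (fun x => A x / (phaseSlope x : ℂ)) =ᶠ[𝓝 x] fun _ => 0 := by
    filter_upwards [isClosed_annularSet.isOpen_compl.mem_nhds hx] with y hy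
    simp [hA0 y hy]
  simp [ibpStep, dirDeriv, this.fderiv_eq]

theorem fderiv_slice_apply {B : PhaseSpace n → ℂ} (hB : ContDiff ℝ ∞ B) (τ r : ℝ) (e ξ v : Eucl n) :
    fderiv ℝ (fun ξ => B (τ, r, e, ξ)) ξ v = fderiv ℝ B (τ, r, e, ξ) (0, 0, 0, v) := by
  have h1 : HasFDerivAt (fun ξ : Eucl n => ((τ, r, e, ξ) : PhaseSpace n))
      ((0 : Eucl n →L[ℝ] ℝ).prod ((0 : Eucl n →L[ℝ] ℝ).prod ((0 : Eucl n →L[ℝ] Eucl n).prod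
        (ContinuousLinearMap.id ℝ (Eucl n))))) ξ :=
    (hasFDerivAt_const τ ξ).prodMk ((hasFDerivAt_const r ξ).prodMk
      ((hasFDerivAt_const e ξ).prodMk (hasFDerivAt_id ξ)))
  have h2 : HasFDerivAt B (fderiv ℝ B (τ, r, e, ξ)) (τ, r, e, ξ) :=
    (hB.differentiable (by simp) _).hasFDerivAt
  have h3 := h2.comp ξ h1
  have : (fun ξ => B (τ, r, e, ξ)) = B ∘ fun ξ : Eucl n => ((τ, r, e, ξ) : PhaseSpace n) := rfl
  rw [this, h3.fderiv]
  simp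

theorem hasCompactSupport_slice {B : PhaseSpace n → ℂ} (hB : ∀ x ∉ annularSet n, B x = 0)
    (τ r : ℝ) (e : Eucl n) : HasCompactSupport (fun ξ => B (τ, r, e, ξ)) := by
  refine HasCompactSupport.intro (isCompact_closedBall (0 : Eucl n) 4) fun ξ hξ => hB _ ?_
  rintro ⟨⟨-, h⟩, -⟩
  exact hξ (by simpa using h)

theorem hasFDerivAt_scaledOmega {τ : ℝ} {ζ : Eucl n}
    (h : 0 < (1 - τ) ^ 2 + τ ^ 2 * (‖ζ‖ ^ 2) ^ 2) :
    HasFDerivAt (scaledOmega τ) ((τ ^ 2 * gradCoeff τ ζ) • innerSL ℝ ζ) ζ := by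
  have h1 : HasFDerivAt (fun ζ : Eucl n => ‖ζ‖ ^ 2) (2 • innerSL ℝ ζ) ζ :=
    (hasStrictFDerivAt_norm_sq ζ).hasFDerivAt
  have h2 := (((h1.pow 2).const_mul (τ ^ 2)).const_add ((1 - τ) ^ 2)).sqrt h.ne'
  refine h2.congr_fderiv ?_
  ext v
  have hs : Real.sqrt ((1 - τ) ^ 2 + τ ^ 2 * (‖ζ‖ ^ 2) ^ 2) ≠ 0 := (Real.sqrt_pos.2 h).ne'
  simp [gradCoeff, scaledOmega]
  field_simp

/-- The phase increment. -/
def phaseDiff (τ r : ℝ) (e ξ : Eucl n) : ℝ := (scaledOmega τ (ξ + r • e) - scaledOmega τ ξ) / τ ^ 2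

theorem scaledOmega_radicand_pos' {τ : ℝ} (hτ : τ < 1) (ζ : Eucl n) :
    0 < (1 - τ) ^ 2 + τ ^ 2 * (‖ζ‖ ^ 2) ^ 2 := by
  have : 0 < 1 - τ := by linarith
  positivity

/-- Dividing by τ² removes the τ² of the gradient of `scaledOmega`, so nothing degenerates as τ → 0.
The condition τ < 1 keeps the radicand positive at the origin as well, so the phase is
differentiable on the whole space. -/
theorem hasFDerivAt_phaseDiff {τ r : ℝ} (hτ0 : 0 < τ) (hτ : τ < 1) (e ξ : Eucl n) :
    HasFDerivAt (phaseDiff τ r e) (gradCoeff τ (ξ + r • e) • innerSL ℝ (ξ + r • e) -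
      gradCoeff τ ξ • innerSL ℝ ξ) ξ := by
  have h1 := (hasFDerivAt_scaledOmega (scaledOmega_radicand_pos' hτ (ξ + r • e))).comp ξ
    ((hasFDerivAt_id ξ).add_const (r • e))
  have h2 := (h1.sub (hasFDerivAt_scaledOmega (scaledOmega_radicand_pos' hτ ξ))).const_mul
    ((τ ^ 2)⁻¹)
  have : phaseDiff τ r e = fun ξ => (τ ^ 2)⁻¹ *
      ((scaledOmega τ ∘ fun ξ => id ξ + r • e) ξ - scaledOmega τ ξ) := by
    ext ξ
    simp [phaseDiff, div_eq_inv_mul]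
  rw [this]
  refine h2.congr_fderiv ?_
  ext v
  simp
  field_simp

/-- The derivative of the exponential along `e` is i l r `phaseSlope` times the exponential.
Dividing the amplitude by `phaseSlope` and integrating by parts therefore gains a factor l r. The
new amplitude does not depend on l. -/
theorem integral_exp_phaseDiff {A : PhaseSpace n → ℂ} (hA : ContDiff ℝ ∞ A)
    (hA0 : ∀ x ∉ annularSet n, A x = 0) {τ r l : ℝ} (hτ0 : 0 < τ) (hτ : τ < 1) {e : Eucl n}
    (he : ‖e‖ = 1) :
    (Complex.I * (l * r : ℝ)) * ∫ ξ, Complex.exp (Complex.I * (l * phaseDiff τ r e ξ : ℝ)) *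
      A (τ, r, e, ξ) =
      -∫ ξ, Complex.exp (Complex.I * (l * phaseDiff τ r e ξ : ℝ)) * ibpStep A (τ, r, e, ξ) := by
  set B : PhaseSpace n → ℂ := fun x => A x / (phaseSlope x : ℂ) with hBdef
  have hB : ContDiff ℝ ∞ B := contDiff_div_phaseSlope hA hA0
  have hB0 : ∀ x ∉ annularSet n, B x = 0 := fun x hx => by simp [hBdef, hA0 x hx]
  set f : Eucl n → ℂ := fun ξ => Complex.exp (Complex.I * (l * phaseDiff τ r e ξ : ℝ)) with hf
  have hfd : ∀ ξ, HasFDerivAt f (f ξ • (Complex.I • (Complex.ofRealCLM.comp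
      (l • (gradCoeff τ (ξ + r • e) • innerSL ℝ (ξ + r • e) - gradCoeff τ ξ • innerSL ℝ ξ))))) ξ := by
    intro ξ
    have h1 := ((hasFDerivAt_phaseDiff (r := r) hτ0 hτ e ξ).const_mul l)
    have h2 := (Complex.ofRealCLM.hasFDerivAt.comp ξ h1).const_mul Complex.I
    exact h2.cexp
  have hcf : Continuous f := continuous_iff_continuousAt.2 fun ξ => (hfd ξ).continuousAt
  have hslice : ∀ {C : PhaseSpace n → ℂ}, ContDiff ℝ ∞ C → (∀ x ∉ annularSet n, C x = 0) →
      Integrable (fun ξ => f ξ * C (τ, r, e, ξ)) := by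
    intro C hC hC0
    refine Continuous.integrable_of_hasCompactSupport ?_
      (hasCompactSupport_slice hC0 τ r e).mul_left
    exact hcf.mul (hC.continuous.comp (by fun_prop))
  have key : ∀ ξ, fderiv ℝ f ξ e * B (τ, r, e, ξ) =
      (Complex.I * (l * r : ℝ)) * (f ξ * A (τ, r, e, ξ)) := by
    intro ξ
    -- Off the annular set both sides vanish, so `phaseSlope` is divided out only where it is
    -- positive.
    by_cases hx : ((τ, r, e, ξ) : PhaseSpace n) ∈ annularSet n
    · obtain ⟨h1, h2⟩ := annularSet_subset hx
      have h3 := mul_phaseSlope τ r he h2 h1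
      have h4 : (phaseSlope ((τ, r, e, ξ) : PhaseSpace n) : ℂ) ≠ 0 := by
        exact_mod_cast (phaseSlope_pos ⟨h1, h2⟩).ne'
      rw [(hfd ξ).fderiv]
      simp only [hBdef, smul_apply, ContinuousLinearMap.comp_apply,
        sub_apply, innerSL_apply_apply, smul_eq_mul, Complex.ofRealCLM_apply]
      rw [← h3]
      push_cast
      field_simp
    · rw [hB0 _ hx, hA0 _ hx]
      simp
  have hstep : ∀ ξ, fderiv ℝ (fun ξ => B (τ, r, e, ξ)) ξ e = ibpStep A (τ, r, e, ξ) :=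
    fun ξ => fderiv_slice_apply hB τ r e ξ e
  have ibp := integral_mul_fderiv_eq_neg_fderiv_mul_of_integrable (μ := volume) (f := f)
    (g := fun ξ => B (τ, r, e, ξ)) (v := e) ?_ ?_ (hslice hB hB0)
    (fun ξ _ => (hfd ξ).differentiableAt)
    (fun ξ _ => (hB.differentiable (by simp)).comp (by fun_prop) ξ)
  · simp_rw [key, hstep] at ibp
    rw [ibp, neg_neg, integral_const_mul]
  · simp_rw [key]
    exact (hslice hA hA0).const_mul _
  · simp_rw [hstep]
    exact hslice (contDiff_ibpStep hA hA0) (ibpStep_eq_zero hA0)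

end Phase

/-! ### The dispersive estimate by autocorrelation -/

section Dispersive

open Filter Topology
open scoped ContDiff

variable {n : ℕ}

/-- Two frequencies of norm at most 4 differ by at most 8, so the relevant points form a compact
set. It includes τ = 0 and τ = 1, the limits of zero and infinite frequency, and hence the bound is
uniform over all block sizes. -/
theorem exists_bound_of_annularSet {A : PhaseSpace n → ℂ} (hA : Continuous A)
    (hA0 : ∀ x ∉ annularSet n, A x = 0) :
    ∃ C : ℝ, 0 ≤ C ∧ ∀ τ ∈ Set.Icc (0 : ℝ) 1, ∀ r : ℝ, 0 ≤ r → ∀ e : Eucl n, ‖e‖ = 1 → ∀ ξ,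
      ‖A (τ, r, e, ξ)‖ ≤ C := by
  have hK : IsCompact (Set.Icc (0 : ℝ) 1 ×ˢ Set.Icc (0 : ℝ) 8 ×ˢ Metric.closedBall (0 : Eucl n) 1 ×ˢ
      Metric.closedBall (0 : Eucl n) 4) :=
    isCompact_Icc.prod (isCompact_Icc.prod ((isCompact_closedBall _ _).prod
      (isCompact_closedBall _ _)))
  obtain ⟨C, hC⟩ := hK.exists_bound_of_continuousOn hA.continuousOn
  refine ⟨max C 0, le_max_right _ _, fun τ hτ r hr e he ξ => ?_⟩
  by_cases hx : ((τ, r, e, ξ) : PhaseSpace n) ∈ annularSet n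
  · obtain ⟨⟨-, h1⟩, -, h2⟩ := hx
    simp only at h1 h2
    refine (hC _ ⟨hτ, ⟨hr, ?_⟩, by simp [he], by simpa using h1⟩).trans (le_max_left _ _)
    have h3 : ‖r • e‖ = r := by rw [norm_smul, he, mul_one, Real.norm_of_nonneg hr]
    have h4 : ‖r • e‖ ≤ ‖ξ + r • e‖ + ‖ξ‖ := by
      have := norm_sub_le (ξ + r • e) ξ
      rwa [add_sub_cancel_left] at this
    show r ≤ 8
    linarith
  · rw [hA0 _ hx, norm_zero]
    exact le_max_right _ _

theorem norm_exp_I_mul_ofReal_mul (x : ℝ) (z : ℂ) :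
    ‖Complex.exp (Complex.I * (x : ℂ)) * z‖ = ‖z‖ := by
  rw [norm_mul, mul_comm Complex.I, Complex.norm_exp_ofReal_mul_I, one_mul]

theorem exists_integral_exp_bound {A : PhaseSpace n → ℂ} (hA : ContDiff ℝ ∞ A)
    (hA0 : ∀ x ∉ annularSet n, A x = 0) :
    ∃ C : ℝ, 0 ≤ C ∧ ∀ τ ∈ Set.Icc (0 : ℝ) 1, ∀ r : ℝ, 0 ≤ r → ∀ e : Eucl n, ‖e‖ = 1 → ∀ l : ℝ,
      ‖∫ ξ, Complex.exp (Complex.I * (l * phaseDiff τ r e ξ : ℝ)) * A (τ, r, e, ξ)‖ ≤ C := by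
  obtain ⟨C, hC0, hC⟩ := exists_bound_of_annularSet hA.continuous hA0
  refine ⟨C * volume.real (Metric.closedBall (0 : Eucl n) 4), by positivity,
    fun τ hτ r hr e he l => ?_⟩
  rw [← setIntegral_eq_integral_of_forall_compl_eq_zero (s := Metric.closedBall (0 : Eucl n) 4)]
  · refine norm_setIntegral_le_of_norm_le_const measure_closedBall_lt_top fun ξ _ => ?_
    rw [norm_exp_I_mul_ofReal_mul]
    exact hC τ hτ r hr e he ξ
  · intro ξ hξ
    rw [hA0, mul_zero]
    rintro ⟨⟨-, h⟩, -⟩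
    exact hξ (by simpa using h)

/-- Smooth amplitudes supported in the annular set are stable under `ibpStep`, so the integration by
parts can be iterated; hence the induction over all such `A` at once. -/
theorem norm_integral_exp_mul_pow (N : ℕ) {A : PhaseSpace n → ℂ} (hA : ContDiff ℝ ∞ A)
    (hA0 : ∀ x ∉ annularSet n, A x = 0) :
    ∃ C : ℝ, 0 ≤ C ∧ ∀ τ ∈ Set.Ioo (0 : ℝ) 1, ∀ r : ℝ, 0 ≤ r → ∀ e : Eucl n, ‖e‖ = 1 → ∀ l : ℝ,
      (|l| * r) ^ N *
      ‖∫ ξ, Complex.exp (Complex.I * (l * phaseDiff τ r e ξ : ℝ)) * A (τ, r, e, ξ)‖ ≤ C := by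
  induction N generalizing A with
  | zero =>
    obtain ⟨C, hC0, hC⟩ := exists_integral_exp_bound hA hA0
    refine ⟨C, hC0, fun τ hτ r hr e he l => ?_⟩
    rw [pow_zero, one_mul]
    exact hC τ ⟨hτ.1.le, hτ.2.le⟩ r hr e he l
  | succ N ih =>
    obtain ⟨C, hC0, hC⟩ := ih (contDiff_ibpStep hA hA0) (ibpStep_eq_zero hA0)
    refine ⟨C, hC0, fun τ hτ r hr e he l => ?_⟩
    have h := congrArg norm (integral_exp_phaseDiff (l := l) (r := r) hA hA0 hτ.1 hτ.2 he)
    rw [norm_mul, norm_neg, norm_mul, Complex.norm_I, one_mul, Complex.norm_real, Real.norm_eq_abs,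
      abs_mul, abs_of_nonneg hr] at h
    rw [pow_succ, mul_assoc, h]
    exact hC τ hτ r hr e he l

theorem exists_integral_exp_decay (N : ℕ) {A : PhaseSpace n → ℂ} (hA : ContDiff ℝ ∞ A)
    (hA0 : ∀ x ∉ annularSet n, A x = 0) :
    ∃ C : ℝ, 0 ≤ C ∧ ∀ τ ∈ Set.Ioo (0 : ℝ) 1, ∀ r : ℝ, 0 ≤ r → ∀ e : Eucl n, ‖e‖ = 1 → ∀ l : ℝ,
      ‖∫ ξ, Complex.exp (Complex.I * (l * phaseDiff τ r e ξ : ℝ)) * A (τ, r, e, ξ)‖ ≤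
        C * (1 + |l| * r) ^ (-(N : ℝ)) := by
  obtain ⟨C₁, hC₁0, hC₁⟩ := exists_integral_exp_bound hA hA0
  obtain ⟨C₂, hC₂0, hC₂⟩ := norm_integral_exp_mul_pow N hA hA0
  refine ⟨2 ^ (N - 1) * (C₁ + C₂), by positivity, fun τ hτ r hr e he l => ?_⟩
  have h1 := hC₁ τ ⟨hτ.1.le, hτ.2.le⟩ r hr e he l
  have h2 := hC₂ τ hτ r hr e he l
  set J := ‖∫ ξ, Complex.exp (Complex.I * (l * phaseDiff τ r e ξ : ℝ)) * A (τ, r, e, ξ)‖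
  have hJ : 0 ≤ J := norm_nonneg _
  have hy : 0 ≤ |l| * r := by positivity
  rw [Real.rpow_neg (by positivity), Real.rpow_natCast, ← div_eq_mul_inv, le_div_iff₀ (by positivity)]
  have h3 := add_pow_le (zero_le_one' ℝ) hy N
  calc J * (1 + |l| * r) ^ N ≤ J * (2 ^ (N - 1) * (1 ^ N + (|l| * r) ^ N)) := by gcongr
    _ = 2 ^ (N - 1) * (J + (|l| * r) ^ N * J) := by ring
    _ ≤ _ := by gcongr

/-- The square of an integral is bounded by the `L¹` norm of the autocorrelation. -/
theorem norm_integral_sq_le_autocorrelation {F : Eucl n → ℂ} (hF : Integrable F) :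
    ‖∫ ξ, F ξ‖ ^ 2 ≤ ∫ η, ‖∫ ξ, F (ξ + η) * starRingEnd ℂ (F ξ)‖ := by
  -- The convolution of F with the reflected conjugate G is the autocorrelation of F, and its
  -- integral is ∫G · ∫F = |∫F|².
  set G : Eucl n → ℂ := fun ξ => starRingEnd ℂ (F (-ξ)) with hG
  have hGi : Integrable G := by
    have h1 : Integrable (fun ξ => F (-ξ)) := hF.comp_neg
    exact (Complex.conjCLE : ℂ →L[ℝ] ℂ).integrable_comp h1
  have h := integral_convolution (μ := volume) (ν := volume) (ContinuousLinearMap.mul ℂ ℂ) hGi hF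
  have h2 : ∫ ξ, G ξ = starRingEnd ℂ (∫ ξ, F ξ) := by
    rw [← integral_conj, hG, integral_neg_eq_self (fun ξ => starRingEnd ℂ (F ξ))]
  have h3 : ‖∫ ξ, F ξ‖ ^ 2 =
      ‖∫ η, convolution G F (ContinuousLinearMap.mul ℂ ℂ) volume η‖ := by
    rw [h, h2]
    simp [sq]
  rw [h3]
  refine (norm_integral_le_integral_norm _).trans (le_of_eq ?_)
  congr 1 with η
  congr 1
  rw [convolution, ← integral_neg_eq_self]
  congr 1 with ξ
  simp [hG, mul_comm, add_comm]

/-- The squared amplitude. -/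
def pairAmplitude (χ : Eucl n → ℝ) (x : PhaseSpace n) : ℂ :=
  ((χ (x.2.2.2 + x.2.1 • x.2.2.1) * χ x.2.2.2 : ℝ) : ℂ) /
    ((scaledOmega x.1 (x.2.2.2 + x.2.1 • x.2.2.1) * scaledOmega x.1 x.2.2.2 : ℝ) : ℂ)

theorem pairAmplitude_eq_zero {χ : Eucl n → ℝ}
    (hχ0 : ∀ ζ, ¬(1 / 4 ≤ ‖ζ‖ ∧ ‖ζ‖ ≤ 4) → χ ζ = 0) :
    ∀ x ∉ annularSet n, pairAmplitude χ x = 0 := by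
  intro x hx
  have : χ (x.2.2.2 + x.2.1 • x.2.2.1) * χ x.2.2.2 = 0 := by
    by_cases h : 1 / 4 ≤ ‖x.2.2.2‖ ∧ ‖x.2.2.2‖ ≤ 4
    · rw [hχ0 (x.2.2.2 + x.2.1 • x.2.2.1) fun h' => hx ⟨h, h'⟩, zero_mul]
    · rw [hχ0 _ h, mul_zero]
  simp [pairAmplitude, this]

theorem contDiff_pairAmplitude {χ : Eucl n → ℝ} (hχ : ContDiff ℝ ∞ χ)
    (hχ0 : ∀ ζ, ¬(1 / 4 ≤ ‖ζ‖ ∧ ‖ζ‖ ≤ 4) → χ ζ = 0) : ContDiff ℝ ∞ (pairAmplitude χ) := by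
  refine contDiff_div_of_support (S := annularSet n) (U := regularSet n) ?_ isClosed_annularSet ?_
    annularSet_subset isOpen_regularSet ?_ ?_
  · refine Complex.ofRealCLM.contDiff.comp ((hχ.comp ?_).mul (hχ.comp ?_)) <;> fun_prop
  · intro x hx
    rw [Complex.ofReal_eq_zero]
    by_cases h : 1 / 4 ≤ ‖x.2.2.2‖ ∧ ‖x.2.2.2‖ ≤ 4
    · rw [hχ0 (x.2.2.2 + x.2.1 • x.2.2.1) fun h' => hx ⟨h, h'⟩, zero_mul]
    · rw [hχ0 _ h, mul_zero]
  · rintro x ⟨hb, ha⟩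
    refine ContDiffAt.contDiffWithinAt (ContDiffAt.mul ?_ ?_)
    · exact contDiffAt_scaledOmega (by fun_prop) (by fun_prop) (scaledOmega_radicand_pos _ ha)
    · exact contDiffAt_scaledOmega (by fun_prop) (by fun_prop) (scaledOmega_radicand_pos _ hb)
  · rintro x ⟨hb, ha⟩
    exact (mul_pos (scaledOmega_pos _ ha) (scaledOmega_pos _ hb)).ne'

/-- The oscillatory integrand of the localised kernel. -/
def waveIntegrand (χ : Eucl n → ℝ) (τ l : ℝ) (x ζ : Eucl n) : ℂ :=
  Complex.exp (Complex.I * ((inner ℝ x ζ + l * (scaledOmega τ ζ / τ ^ 2) : ℝ) : ℂ)) *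
    ((χ ζ / scaledOmega τ ζ : ℝ) : ℂ)

/-- The linear phase contributes only a unimodular factor independent of `ξ`. This is why the final
estimate is uniform in `x`. -/
theorem waveIntegrand_mul_conj (χ : Eucl n → ℝ) (τ l : ℝ) (x e ξ : Eucl n) (r : ℝ) :
    waveIntegrand χ τ l x (ξ + r • e) * starRingEnd ℂ (waveIntegrand χ τ l x ξ) =
      Complex.exp (Complex.I * ((inner ℝ x (r • e) : ℝ) : ℂ)) *
      (Complex.exp (Complex.I * (l * phaseDiff τ r e ξ : ℝ)) *
        pairAmplitude χ (τ, r, e, ξ)) := by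
  simp only [waveIntegrand, map_mul, Complex.conj_ofReal, ← Complex.exp_conj, Complex.conj_I]
  rw [mul_mul_mul_comm, ← Complex.exp_add, ← mul_assoc (Complex.exp _) (Complex.exp _),
    ← Complex.exp_add]
  congr 1
  · congr 1
    simp only [phaseDiff, inner_add_right]
    push_cast
    ring
  · simp only [pairAmplitude]
    push_cast
    rw [div_mul_div_comm]

theorem continuous_scaledOmega (τ : ℝ) : Continuous (scaledOmega τ : Eucl n → ℝ) := by
  unfold scaledOmega
  fun_prop

theorem norm_waveIntegrand (χ : Eucl n → ℝ) (τ l : ℝ) (x ζ : Eucl n) :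
    ‖waveIntegrand χ τ l x ζ‖ = |χ ζ / scaledOmega τ ζ| := by
  rw [waveIntegrand, norm_exp_I_mul_ofReal_mul, Complex.norm_real, Real.norm_eq_abs]

theorem integrable_waveIntegrand {χ : Eucl n → ℝ} (hχ : ContDiff ℝ ∞ χ)
    (hχ0 : ∀ ζ, ¬(1 / 4 ≤ ‖ζ‖ ∧ ‖ζ‖ ≤ 4) → χ ζ = 0) {τ : ℝ} (hτ : τ < 1) (l : ℝ) (x : Eucl n) :
    Integrable (waveIntegrand χ τ l x) := by
  have hs := continuous_scaledOmega (n := n) τ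
  have hs0 : ∀ ζ : Eucl n, scaledOmega τ ζ ≠ 0 := fun ζ =>
    (Real.sqrt_pos.2 (scaledOmega_radicand_pos' hτ ζ)).ne'
  refine Continuous.integrable_of_hasCompactSupport ?_ ?_
  · have h1 : Continuous fun ζ => χ ζ / scaledOmega τ ζ := hχ.continuous.div hs hs0
    unfold waveIntegrand
    fun_prop
  · refine HasCompactSupport.intro (isCompact_closedBall (0 : Eucl n) 4) fun ζ hζ => ?_
    have : χ ζ = 0 := hχ0 ζ fun h => hζ (by simpa using h.2)
    simp [waveIntegrand, this]

/-- Uniform dispersive estimate for frequency-localised oscillatory integrals. -/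
theorem exists_waveIntegrand_bound (hn : 1 ≤ n) {χ : Eucl n → ℝ} (hχ : ContDiff ℝ ∞ χ)
    (hχ0 : ∀ ζ, ¬(1 / 4 ≤ ‖ζ‖ ∧ ‖ζ‖ ≤ 4) → χ ζ = 0) :
    ∃ C : ℝ, 0 ≤ C ∧ ∀ τ ∈ Set.Ioo (0 : ℝ) 1, ∀ (l : ℝ) (x : Eucl n), l ≠ 0 →
      ‖∫ ζ, waveIntegrand χ τ l x ζ‖ ≤ C * |l| ^ (-(n / 2 : ℝ)) := by
  -- Decay of order n + 1 makes the bound integrable over the n-dimensional displacement.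
  obtain ⟨C, hC0, hC⟩ := exists_integral_exp_decay (n + 1) (contDiff_pairAmplitude hχ hχ0)
    (pairAmplitude_eq_zero hχ0)
  set D : ℝ := ∫ η : Eucl n, (1 + ‖η‖) ^ (-((n + 1 : ℕ) : ℝ)) with hD
  have hD0 : 0 ≤ D := integral_nonneg fun η => by positivity
  have hint : Integrable (fun η : Eucl n => (1 + ‖η‖) ^ (-((n + 1 : ℕ) : ℝ))) :=
    integrable_one_add_norm (by simp)
  refine ⟨Real.sqrt (C * D), by positivity, fun τ hτ l x hl => ?_⟩
  have hl' : 0 < |l| := abs_pos.2 hl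
  have hJ : ∀ η : Eucl n, ‖∫ ξ, waveIntegrand χ τ l x (ξ + η) *
      starRingEnd ℂ (waveIntegrand χ τ l x ξ)‖ ≤
        C * (1 + ‖|l| • η‖) ^ (-((n + 1 : ℕ) : ℝ)) := by
    intro η
    -- Polar form of the displacement. At η = 0 any unit vector serves, and one exists because n ≥
    -- 1.
    obtain ⟨e, he, hη⟩ : ∃ e : Eucl n, ‖e‖ = 1 ∧ η = ‖η‖ • e := by
      by_cases h : η = 0
      · have : Nonempty (Fin n) := ⟨⟨0, hn⟩⟩
        obtain ⟨e, he⟩ := exists_norm_eq (Eucl n) zero_le_one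
        exact ⟨e, he, by simp [h]⟩
      · have h' : ‖η‖ ≠ 0 := norm_ne_zero_iff.2 h
        exact ⟨‖η‖⁻¹ • η, by rw [norm_smul, norm_inv, norm_norm, inv_mul_cancel₀ h'],
          by rw [smul_smul, mul_inv_cancel₀ h', one_smul]⟩
    have h1 : ∀ ξ, waveIntegrand χ τ l x (ξ + η) * starRingEnd ℂ (waveIntegrand χ τ l x ξ) = _ :=
      fun ξ => (congrArg (fun v => waveIntegrand χ τ l x (ξ + v) *
        starRingEnd ℂ (waveIntegrand χ τ l x ξ)) hη).trans
          (waveIntegrand_mul_conj χ τ l x e ξ ‖η‖)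
    simp_rw [h1]
    rw [integral_const_mul, norm_exp_I_mul_ofReal_mul, norm_smul, Real.norm_eq_abs, abs_abs]
    exact hC τ hτ ‖η‖ (norm_nonneg _) e he l
  have hsq := norm_integral_sq_le_autocorrelation (integrable_waveIntegrand hχ hχ0 hτ.2 l x)
  have hbd : ∫ η, ‖∫ ξ, waveIntegrand χ τ l x (ξ + η) *
      starRingEnd ℂ (waveIntegrand χ τ l x ξ)‖ ≤ C * (|l| ^ (-(n : ℝ)) * D) := by
    refine (integral_mono_of_nonneg (Eventually.of_forall fun η => norm_nonneg _)
      ((hint.comp_smul hl'.ne').const_mul C) (Eventually.of_forall hJ)).trans (le_of_eq ?_)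
    -- Substituting |l|η produces the factor |l|^{-n}, whose square root is the dispersive rate.
    rw [integral_const_mul, Measure.integral_comp_smul volume
      (fun η : Eucl n => (1 + ‖η‖) ^ (-((n + 1 : ℕ) : ℝ)))]
    rw [finrank_euclideanSpace_fin, abs_of_nonneg (by positivity), smul_eq_mul,
      Real.rpow_neg hl'.le, Real.rpow_natCast]
  have h2 := hsq.trans hbd
  refine (Real.le_sqrt (norm_nonneg _) (by positivity)).2 h2 |>.trans (le_of_eq ?_)
  rw [mul_left_comm, mul_comm, Real.sqrt_mul (by positivity)]
  congr 1
  rw [Real.sqrt_eq_rpow, ← Real.rpow_mul hl'.le]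
  congr 1
  ring

/-- Trivial bound for frequency-localised oscillatory integrals. -/
theorem exists_waveIntegrand_bound_trivial (hn : 1 ≤ n) {χ : Eucl n → ℝ} (hχ : ContDiff ℝ ∞ χ)
    (hχ0 : ∀ ζ, ¬(1 / 4 ≤ ‖ζ‖ ∧ ‖ζ‖ ≤ 4) → χ ζ = 0) :
    ∃ C : ℝ, 0 ≤ C ∧ ∀ τ ∈ Set.Ioo (0 : ℝ) 1, ∀ (l : ℝ) (x : Eucl n),
      ‖∫ ζ, waveIntegrand χ τ l x ζ‖ ≤ C := by
  obtain ⟨C, hC0, hC⟩ := exists_bound_of_annularSet (contDiff_pairAmplitude hχ hχ0).continuous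
    (pairAmplitude_eq_zero hχ0)
  have : Nonempty (Fin n) := ⟨⟨0, hn⟩⟩
  obtain ⟨e, he⟩ := exists_norm_eq (Eucl n) zero_le_one
  refine ⟨Real.sqrt C * volume.real (Metric.closedBall (0 : Eucl n) 4), by positivity,
    fun τ hτ l x => ?_⟩
  rw [← setIntegral_eq_integral_of_forall_compl_eq_zero (s := Metric.closedBall (0 : Eucl n) 4)]
  · refine norm_setIntegral_le_of_norm_le_const measure_closedBall_lt_top fun ζ _ => ?_
    rw [norm_waveIntegrand]
    refine Real.abs_le_sqrt ?_
    -- At r = 0 the pair amplitude is the square of χ/σ, so its bound yields one for χ/σ.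
    have h := hC τ ⟨hτ.1.le, hτ.2.le⟩ 0 le_rfl e he ζ
    simp only [pairAmplitude, zero_smul, add_zero] at h
    rw [← Complex.ofReal_div, Complex.norm_real, Real.norm_eq_abs] at h
    refine (le_abs_self _).trans (le_trans (le_of_eq ?_) h)
    congr 1
    ring
  · intro ζ hζ
    have : χ ζ = 0 := hχ0 ζ fun h => hζ (by simpa using h.2)
    simp [waveIntegrand, this]

end Dispersive

/-! ### Kernel bounds for a single frequency block -/

section Kernel

open Filter Topology
open scoped ContDiff

variable {n : ℕ}

/-- The (unnormalised) inverse Fourier integral of a real symbol. -/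
def symbolKernel (m : Eucl n → ℝ) (x : Eucl n) : ℂ :=
  ∫ ξ, Complex.exp (Complex.I * ((inner ℝ x ξ : ℝ) : ℂ)) * (m ξ : ℂ)

/-- With τ = ρ²/(1 + ρ²) one has 1 - τ = 1/(1 + ρ²), so all block sizes fall into a family with
parameter in (0,1). -/
theorem omegaSymbol_smul {ρ : ℝ} (ζ : Eucl n) :
    omegaSymbol (ρ • ζ) = (1 + ρ ^ 2) * scaledOmega (ρ ^ 2 / (1 + ρ ^ 2)) ζ := by
  have h : 0 < 1 + ρ ^ 2 := by positivity
  rw [omegaSymbol, scaledOmega, Real.sqrt_eq_iff_mul_self_eq (by positivity) (by positivity),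
    mul_mul_mul_comm, Real.mul_self_sqrt (by positivity), norm_smul, mul_pow, Real.norm_eq_abs,
    Even.pow_abs (by decide)]
  field_simp
  ring

theorem one_le_omegaSymbol (ξ : Eucl n) : 1 ≤ omegaSymbol ξ := by
  rw [omegaSymbol]
  exact Real.one_le_sqrt.2 (by linarith [show 0 ≤ ‖ξ‖ ^ 4 by positivity])

theorem sq_norm_le_omegaSymbol (ξ : Eucl n) : ‖ξ‖ ^ 2 ≤ omegaSymbol ξ := by
  rw [omegaSymbol]
  exact Real.le_sqrt_of_sq_le (by ring_nf; linarith)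

theorem abs_beamSymbol_le (t : ℝ) (ξ : Eucl n) : |beamSymbol t ξ| ≤ (omegaSymbol ξ)⁻¹ := by
  have h := one_le_omegaSymbol ξ
  rw [beamSymbol, abs_mul, abs_of_pos (by positivity)]
  exact mul_le_of_le_one_right (by positivity) (Real.abs_sin_le_one _)

/-- Euler's formula splits the sine into the phases ±l with l = tρ⁴/(1 + ρ²). The prefactor 1/(1 +
ρ²) comes from ω⁻¹. -/
theorem beamSymbol_smul_mul {χ : Eucl n → ℝ} {t ρ : ℝ} (hρ : 0 < ρ) (x ζ : Eucl n) :
    Complex.exp (Complex.I * ((inner ℝ x (ρ • ζ) : ℝ) : ℂ)) *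
      ((beamSymbol t (ρ • ζ) * χ (ρ⁻¹ • ρ • ζ) : ℝ) : ℂ) =
    (((1 + ρ ^ 2)⁻¹ : ℝ) : ℂ) * (2 * Complex.I)⁻¹ *
      (waveIntegrand χ (ρ ^ 2 / (1 + ρ ^ 2)) (t * ρ ^ 4 / (1 + ρ ^ 2)) (ρ • x) ζ -
        waveIntegrand χ (ρ ^ 2 / (1 + ρ ^ 2)) (-(t * ρ ^ 4 / (1 + ρ ^ 2))) (ρ • x) ζ) := by
  have h : 0 < 1 + ρ ^ 2 := by positivity
  rw [smul_smul, inv_mul_cancel₀ hρ.ne', one_smul]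
  unfold beamSymbol waveIntegrand
  rw [omegaSymbol_smul, inner_smul_right, inner_smul_left]
  simp only [conj_trivial]
  set s := scaledOmega (ρ ^ 2 / (1 + ρ ^ 2)) ζ
  have e1 : t * ρ ^ 4 / (1 + ρ ^ 2) * (s / (ρ ^ 2 / (1 + ρ ^ 2)) ^ 2) =
      t * ((1 + ρ ^ 2) * s) := by
    field_simp
  rw [neg_mul, e1]
  set θ := t * ((1 + ρ ^ 2) * s)
  push_cast
  rw [Complex.sin, mul_add Complex.I, mul_add Complex.I, Complex.exp_add, Complex.exp_add,
    show -(θ : ℂ) * Complex.I = Complex.I * -θ by ring, mul_comm (θ : ℂ) Complex.I, mul_inv, mul_inv]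
  have hI : (Complex.I)⁻¹ = -Complex.I := Complex.inv_I
  rw [hI]
  ring

theorem norm_symbolKernel_block_le {χ : Eucl n → ℝ} (hχ : ContDiff ℝ ∞ χ)
    (hχ0 : ∀ ζ, ¬(1 / 4 ≤ ‖ζ‖ ∧ ‖ζ‖ ≤ 4) → χ ζ = 0) {t ρ B : ℝ} (hρ : 0 < ρ) (x : Eucl n)
    (hB : ∀ l : ℝ, |l| = |t| * ρ ^ 4 / (1 + ρ ^ 2) →
      ‖∫ ζ, waveIntegrand χ (ρ ^ 2 / (1 + ρ ^ 2)) l (ρ • x) ζ‖ ≤ B) :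
    ‖symbolKernel (fun ξ => beamSymbol t ξ * χ (ρ⁻¹ • ξ)) x‖ ≤ ρ ^ n / (1 + ρ ^ 2) * B := by
  have h : 0 < 1 + ρ ^ 2 := by positivity
  have hτ : ρ ^ 2 / (1 + ρ ^ 2) < 1 := by rw [div_lt_one h]; linarith
  have hsub := Measure.integral_comp_smul (volume : Measure (Eucl n))
    (fun ξ => Complex.exp (Complex.I * ((inner ℝ x ξ : ℝ) : ℂ)) *
      ((beamSymbol t ξ * χ (ρ⁻¹ • ξ) : ℝ) : ℂ)) ρ
  simp_rw [beamSymbol_smul_mul hρ] at hsub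
  rw [integral_const_mul, integral_sub (integrable_waveIntegrand hχ hχ0 hτ _ _)
    (integrable_waveIntegrand hχ hχ0 hτ _ _), finrank_euclideanSpace_fin] at hsub
  have hn := congrArg norm hsub
  rw [norm_smul, norm_mul, norm_mul, Complex.norm_real, Real.norm_of_nonneg (by positivity),
    norm_inv, norm_mul, Complex.norm_I, Complex.norm_ofNat, Real.norm_of_nonneg (by positivity),
    abs_of_nonneg (by positivity)] at hn
  have habs : |t * ρ ^ 4 / (1 + ρ ^ 2)| = |t| * ρ ^ 4 / (1 + ρ ^ 2) := by
    rw [abs_div, abs_mul, abs_of_pos h, abs_of_nonneg (by positivity : 0 ≤ ρ ^ 4)]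
  have h1 := hB _ habs
  have h2 := hB _ ((abs_neg _).trans habs)
  have h3 := (norm_sub_le _ _).trans (add_le_add h1 h2)
  have hk : ‖symbolKernel (fun ξ => beamSymbol t ξ * χ (ρ⁻¹ • ξ)) x‖ = ρ ^ n * ((ρ ^ n)⁻¹ *
      ‖symbolKernel (fun ξ => beamSymbol t ξ * χ (ρ⁻¹ • ξ)) x‖) := by
    field_simp
  rw [hk]
  unfold symbolKernel
  rw [← hn, show ρ ^ n / (1 + ρ ^ 2) * B = ρ ^ n * (B / (1 + ρ ^ 2)) by ring]
  refine mul_le_mul_of_nonneg_left ?_ (by positivity)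
  calc _ ≤ (1 + ρ ^ 2)⁻¹ * (2 * 1)⁻¹ * (B + B) := by gcongr
    _ = B / (1 + ρ ^ 2) := by ring

/-- Kernel bounds for a frequency block of size `ρ`. -/
theorem exists_symbolKernel_block_bound (hn : 1 ≤ n) {χ : Eucl n → ℝ} (hχ : ContDiff ℝ ∞ χ)
    (hχ0 : ∀ ζ, ¬(1 / 4 ≤ ‖ζ‖ ∧ ‖ζ‖ ≤ 4) → χ ζ = 0) :
    ∃ C : ℝ, 0 ≤ C ∧ ∀ (ρ t : ℝ) (x : Eucl n), 0 < ρ → t ≠ 0 →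
      ‖symbolKernel (fun ξ => beamSymbol t ξ * χ (ρ⁻¹ • ξ)) x‖ ≤ C * (ρ ^ n / (1 + ρ ^ 2)) ∧
      ‖symbolKernel (fun ξ => beamSymbol t ξ * χ (ρ⁻¹ • ξ)) x‖ ≤
        C * (ρ ^ n / (1 + ρ ^ 2) * (|t| * ρ ^ 4 / (1 + ρ ^ 2)) ^ (-(n / 2 : ℝ))) := by
  obtain ⟨C₁, hC₁0, hC₁⟩ := exists_waveIntegrand_bound_trivial hn hχ hχ0
  obtain ⟨C₂, hC₂0, hC₂⟩ := exists_waveIntegrand_bound hn hχ hχ0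
  refine ⟨max C₁ C₂, le_max_of_le_left hC₁0, fun ρ t x hρ ht => ?_⟩
  have h : 0 < 1 + ρ ^ 2 := by positivity
  have hτ : ρ ^ 2 / (1 + ρ ^ 2) ∈ Set.Ioo (0 : ℝ) 1 :=
    ⟨by positivity, by rw [div_lt_one h]; linarith⟩
  have ht' : 0 < |t| := abs_pos.2 ht
  constructor
  · rw [mul_comm]
    refine norm_symbolKernel_block_le hχ hχ0 hρ x fun l _ => ?_
    exact (hC₁ _ hτ _ _).trans (le_max_left _ _)
  · rw [mul_left_comm]
    refine norm_symbolKernel_block_le hχ hχ0 hρ x fun l hl => ?_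
    have hl0 : l ≠ 0 := by
      rw [← abs_pos, hl]
      positivity
    refine (hC₂ _ hτ l _ hl0).trans ?_
    rw [hl]
    gcongr
    exact le_max_right _ _

/-- For ρ ≥ 1 the oscillation parameter is at least |t|ρ²/2. The volume factor ρ^n cancels
(ρ²)^{-n/2}, leaving the decay |t|^{-n/2}. -/
theorem exists_symbolKernel_high_bound (hn : 1 ≤ n) {χ : Eucl n → ℝ} (hχ : ContDiff ℝ ∞ χ)
    (hχ0 : ∀ ζ, ¬(1 / 4 ≤ ‖ζ‖ ∧ ‖ζ‖ ≤ 4) → χ ζ = 0) :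
    ∃ C : ℝ, 0 ≤ C ∧ ∀ (ρ t : ℝ) (x : Eucl n), 1 ≤ ρ → t ≠ 0 →
      ‖symbolKernel (fun ξ => beamSymbol t ξ * χ (ρ⁻¹ • ξ)) x‖ ≤
        C * ((ρ ^ 2)⁻¹ * min (ρ ^ n) (|t| ^ (-(n / 2 : ℝ)))) := by
  obtain ⟨C, hC0, hC⟩ := exists_symbolKernel_block_bound hn hχ hχ0
  refine ⟨2 ^ (n / 2 : ℝ) * C, by positivity, fun ρ t x hρ ht => ?_⟩
  have hρ0 : 0 < ρ := by linarith
  have ht' : 0 < |t| := abs_pos.2 ht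
  obtain ⟨h1, h2⟩ := hC ρ t x hρ0 ht
  have h2n : (1 : ℝ) ≤ 2 ^ (n / 2 : ℝ) := Real.one_le_rpow (by norm_num) (by positivity)
  have hle : (1 + ρ ^ 2)⁻¹ ≤ (ρ ^ 2)⁻¹ := by gcongr; linarith
  rw [mul_min_of_nonneg _ _ (by positivity), mul_min_of_nonneg _ _ (by positivity)]
  refine le_min ?_ ?_
  · calc _ ≤ C * (ρ ^ n / (1 + ρ ^ 2)) := h1
      _ = 1 * C * ((1 + ρ ^ 2)⁻¹ * ρ ^ n) := by ring
      _ ≤ _ := by gcongr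
  · have hb : |t| * ρ ^ 2 / 2 ≤ |t| * ρ ^ 4 / (1 + ρ ^ 2) := by
      rw [div_le_div_iff₀ (by norm_num) (by positivity)]
      have : ρ ^ 2 ≥ 1 := one_le_pow₀ hρ
      nlinarith [mul_nonneg ht'.le (mul_nonneg (sq_nonneg ρ) (sub_nonneg.2 this))]
    have hb2 : (|t| * ρ ^ 4 / (1 + ρ ^ 2)) ^ (-(n / 2 : ℝ)) ≤
        (|t| * ρ ^ 2 / 2) ^ (-(n / 2 : ℝ)) :=
      Real.rpow_le_rpow_of_nonpos (by positivity) hb (by simp; positivity)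
    have hb3 : (|t| * ρ ^ 2 / 2) ^ (-(n / 2 : ℝ)) =
        2 ^ (n / 2 : ℝ) * (ρ ^ n)⁻¹ * |t| ^ (-(n / 2 : ℝ)) := by
      rw [Real.div_rpow (by positivity) (by norm_num), Real.mul_rpow ht'.le (by positivity),
        Real.rpow_neg (by norm_num : (0 : ℝ) ≤ 2), Real.rpow_neg (by positivity : 0 ≤ ρ ^ 2),
        ← Real.rpow_natCast ρ 2, ← Real.rpow_mul hρ0.le, ← Real.rpow_natCast ρ n]
      rw [show ((2 : ℕ) : ℝ) * (n / 2) = n by push_cast; ring]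
      field_simp
    calc _ ≤ C * (ρ ^ n / (1 + ρ ^ 2) * (|t| * ρ ^ 4 / (1 + ρ ^ 2)) ^ (-(n / 2 : ℝ))) := h2
      _ ≤ C * (ρ ^ n * (ρ ^ 2)⁻¹ * (2 ^ (n / 2 : ℝ) * (ρ ^ n)⁻¹ * |t| ^ (-(n / 2 : ℝ)))) := by
          rw [← hb3, div_eq_mul_inv]
          gcongr
      _ = _ := by
          field_simp

/-- For ρ ≤ 1 the parameter is only about |t|ρ⁴, because the phase is quartic near the origin. The
net power is ρ^n (ρ⁴)^{-n/2} = ρ^{-n}, which grows as ρ → 0. -/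
theorem exists_symbolKernel_small_bound (hn : 1 ≤ n) {χ : Eucl n → ℝ} (hχ : ContDiff ℝ ∞ χ)
    (hχ0 : ∀ ζ, ¬(1 / 4 ≤ ‖ζ‖ ∧ ‖ζ‖ ≤ 4) → χ ζ = 0) :
    ∃ C : ℝ, 0 ≤ C ∧ ∀ (ρ t : ℝ) (x : Eucl n), 0 < ρ → ρ ≤ 1 → t ≠ 0 →
      ‖symbolKernel (fun ξ => beamSymbol t ξ * χ (ρ⁻¹ • ξ)) x‖ ≤
        C * ((ρ ^ n)⁻¹ * |t| ^ (-(n / 2 : ℝ))) := by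
  obtain ⟨C, hC0, hC⟩ := exists_symbolKernel_block_bound hn hχ hχ0
  refine ⟨2 ^ (n / 2 : ℝ) * C, by positivity, fun ρ t x hρ0 hρ ht => ?_⟩
  have ht' : 0 < |t| := abs_pos.2 ht
  obtain ⟨-, h2⟩ := hC ρ t x hρ0 ht
  have hb : |t| * ρ ^ 4 / 2 ≤ |t| * ρ ^ 4 / (1 + ρ ^ 2) := by
    gcongr
    nlinarith
  have hb2 : (|t| * ρ ^ 4 / (1 + ρ ^ 2)) ^ (-(n / 2 : ℝ)) ≤
      (|t| * ρ ^ 4 / 2) ^ (-(n / 2 : ℝ)) :=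
    Real.rpow_le_rpow_of_nonpos (by positivity) hb (by simp; positivity)
  have hb3 : (|t| * ρ ^ 4 / 2) ^ (-(n / 2 : ℝ)) =
      2 ^ (n / 2 : ℝ) * (ρ ^ n * ρ ^ n)⁻¹ * |t| ^ (-(n / 2 : ℝ)) := by
    rw [Real.div_rpow (by positivity) (by norm_num), Real.mul_rpow ht'.le (by positivity),
      Real.rpow_neg (by norm_num : (0 : ℝ) ≤ 2), Real.rpow_neg (by positivity : 0 ≤ ρ ^ 4),
      ← Real.rpow_natCast ρ 4, ← Real.rpow_mul hρ0.le, ← pow_add, ← Real.rpow_natCast ρ (n + n)]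
    rw [show ((4 : ℕ) : ℝ) * (n / 2) = (n + n : ℕ) by push_cast; ring]
    field_simp
  have hle : ρ ^ n / (1 + ρ ^ 2) ≤ ρ ^ n := div_le_self (by positivity) (by nlinarith)
  calc _ ≤ C * (ρ ^ n / (1 + ρ ^ 2) * (|t| * ρ ^ 4 / (1 + ρ ^ 2)) ^ (-(n / 2 : ℝ))) := h2
    _ ≤ C * (ρ ^ n * (2 ^ (n / 2 : ℝ) * (ρ ^ n * ρ ^ n)⁻¹ * |t| ^ (-(n / 2 : ℝ)))) := by
        rw [← hb3]
        gcongr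
    _ = _ := by
        field_simp

end Kernel

/-! ### Low frequencies: dyadic decomposition near the origin -/

section LowFrequency

open Filter Topology
open scoped ContDiff

variable {n : ℕ}

theorem IsCutoff.eq_zero {Φ : Eucl n → ℝ} (hΦ : IsCutoff Φ) {ξ : Eucl n} (h : 2 < ‖ξ‖) :
    Φ ξ = 0 := by
  by_contra h'
  have := hΦ.supp (subset_tsupport _ h')
  simp at this
  linarith

theorem IsCutoff.smul_eq_zero {Φ : Eucl n → ℝ} (hΦ : IsCutoff Φ) {c : ℝ} (hc : 0 ≤ c) {ξ : Eucl n}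
    (h : 2 < c * ‖ξ‖) : Φ (c • ξ) = 0 :=
  hΦ.eq_zero (by rwa [norm_smul, Real.norm_of_nonneg hc])

theorem IsCutoff.smul_eq_one {Φ : Eucl n → ℝ} (hΦ : IsCutoff Φ) {c : ℝ} (hc : 0 ≤ c) {ξ : Eucl n}
    (h : c * ‖ξ‖ ≤ 1) : Φ (c • ξ) = 1 :=
  hΦ.eq_one _ (by rwa [norm_smul, Real.norm_of_nonneg hc])

/-- Smooth cutoffs to an annulus, obtained from a cutoff to a ball. -/
def annulusCutoff (Φ : Eucl n → ℝ) (c : ℝ) (ζ : Eucl n) : ℝ := Φ ((1 / 2 : ℝ) • ζ) - Φ (c • ζ)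

theorem contDiff_annulusCutoff {Φ : Eucl n → ℝ} (hΦ : IsCutoff Φ) (c : ℝ) :
    ContDiff ℝ ∞ (annulusCutoff Φ c) :=
  (hΦ.smooth.comp (contDiff_const_smul _)).sub (hΦ.smooth.comp (contDiff_const_smul _))

/-- For |ζ| < 1/4 both dilates of Φ equal 1 since c ≤ 4, and for |ζ| > 4 both vanish since c ≥ 1/2.
The value c = 1 serves for telescoping sums. The value c = 4 gives a cutoff equal to 1 on 1/2 ≤ |ζ|
≤ 2, which contains the support of ψ. -/
theorem annulusCutoff_eq_zero {Φ : Eucl n → ℝ} (hΦ : IsCutoff Φ) {c : ℝ} (hc1 : 1 / 2 ≤ c)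
    (hc4 : c ≤ 4) (ζ : Eucl n) (h : ¬(1 / 4 ≤ ‖ζ‖ ∧ ‖ζ‖ ≤ 4)) : annulusCutoff Φ c ζ = 0 := by
  have h0 := norm_nonneg ζ
  rw [annulusCutoff]
  rw [not_and_or, not_le, not_le] at h
  rcases h with h | h
  · rw [hΦ.smul_eq_one (by norm_num) (by linarith), hΦ.smul_eq_one (by linarith) (by nlinarith),
      sub_self]
  · rw [hΦ.smul_eq_zero (by norm_num) (by linarith), hΦ.smul_eq_zero (by linarith) (by nlinarith),
      sub_self]

theorem continuous_beamSymbol (t : ℝ) : Continuous (beamSymbol (n := n) t) :=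
  (hasTemperateGrowth_beamSymbol t).1.continuous

theorem integrable_exp_mul_symbol {m : Eucl n → ℝ} (hm : Continuous m) (hs : HasCompactSupport m)
    (x : Eucl n) :
    Integrable (fun ξ => Complex.exp (Complex.I * ((inner ℝ x ξ : ℝ) : ℂ)) * (m ξ : ℂ)) := by
  refine Continuous.integrable_of_hasCompactSupport (by fun_prop) ?_
  exact HasCompactSupport.mul_left (hs.comp_left Complex.ofReal_zero)

theorem symbolKernel_add {m₁ m₂ : Eucl n → ℝ} (h1 : Continuous m₁) (h1' : HasCompactSupport m₁)
    (h2 : Continuous m₂) (h2' : HasCompactSupport m₂) (x : Eucl n) :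
    symbolKernel (fun ξ => m₁ ξ + m₂ ξ) x = symbolKernel m₁ x + symbolKernel m₂ x := by
  unfold symbolKernel
  rw [← integral_add (integrable_exp_mul_symbol h1 h1' x) (integrable_exp_mul_symbol h2 h2' x)]
  congr 1 with ξ
  push_cast
  ring

theorem norm_symbolKernel_le {m : Eucl n → ℝ} (x : Eucl n) : ‖symbolKernel m x‖ ≤ ∫ ξ, |m ξ| := by
  refine (norm_integral_le_integral_norm _).trans (le_of_eq ?_)
  congr 1 with ξ
  rw [norm_exp_I_mul_ofReal_mul, Complex.norm_real, Real.norm_eq_abs]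

theorem IsCutoff.hasCompactSupport_smul {Φ : Eucl n → ℝ} (hΦ : IsCutoff Φ) {c : ℝ} (hc : 0 < c) :
    HasCompactSupport (fun ξ => Φ (c • ξ)) := by
  refine HasCompactSupport.intro (isCompact_closedBall (0 : Eucl n) (2 / c)) fun ξ hξ => ?_
  refine hΦ.smul_eq_zero hc.le ?_
  simp only [Metric.mem_closedBall, dist_zero_right, not_le] at hξ
  rwa [div_lt_iff₀ hc, mul_comm] at hξ

theorem IsCutoff.continuous_smul {Φ : Eucl n → ℝ} (hΦ : IsCutoff Φ) (c : ℝ) :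
    Continuous (fun ξ => Φ (c • ξ)) :=
  hΦ.smooth.continuous.comp (continuous_const_smul c)

theorem norm_symbolKernel_low_le {Φ : Eucl n → ℝ} (hΦ : IsCutoff Φ) (t : ℝ) {c : ℝ} (hc : 0 < c)
    (x : Eucl n) :
    ‖symbolKernel (fun ξ => beamSymbol t ξ * Φ (c • ξ)) x‖ ≤ (c ^ n)⁻¹ * ∫ ξ, Φ ξ := by
  refine (norm_symbolKernel_le x).trans ?_
  have h := Measure.integral_comp_smul (volume : Measure (Eucl n)) Φ c
  rw [finrank_euclideanSpace_fin, abs_of_nonneg (by positivity), smul_eq_mul] at h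
  rw [← h]
  refine integral_mono_of_nonneg (Eventually.of_forall fun ξ => abs_nonneg _)
    ((hΦ.continuous_smul c).integrable_of_hasCompactSupport (hΦ.hasCompactSupport_smul hc))
    (Eventually.of_forall fun ξ => ?_)
  simp only [abs_mul, abs_of_nonneg (hΦ.nonneg (c • ξ))]
  refine mul_le_of_le_one_left (hΦ.nonneg _) ?_
  exact (abs_beamSymbol_le t ξ).trans (inv_le_one_of_one_le₀ (one_le_omegaSymbol ξ))

/-- Annuli of radius 2^{-j}, j < J, contribute about 2^{jn}|t|^{-n/2}, a geometric sum dominated by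
its last terms; the remaining ball contributes 2^{-Jn} by volume. The two balance when 2^J is about
|t|^{1/4}. -/
theorem exists_symbolKernel_low_bound (hn : 1 ≤ n) {Φ : Eucl n → ℝ} (hΦ : IsCutoff Φ) :
    ∃ C : ℝ, 0 ≤ C ∧ ∀ (t : ℝ) (x : Eucl n), t ≠ 0 →
      ‖symbolKernel (fun ξ => beamSymbol t ξ * Φ ((1 / 2 : ℝ) • ξ)) x‖ ≤
        C * min 1 (|t| ^ (-(n / 4 : ℝ))) := by
  obtain ⟨C, hC0, hC⟩ := exists_symbolKernel_small_bound hn (contDiff_annulusCutoff hΦ 1)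
    (annulusCutoff_eq_zero hΦ (by norm_num) (by norm_num))
  set D : ℝ := ∫ ξ, Φ ξ with hD
  have hD0 : 0 ≤ D := integral_nonneg hΦ.nonneg
  have hlow : ∀ (J : ℕ) (t : ℝ) (x : Eucl n),
      ‖symbolKernel (fun ξ => beamSymbol t ξ * Φ ((2 ^ J / 2 : ℝ) • ξ)) x‖ ≤
        2 ^ n * D * ((2 ^ J : ℝ) ^ n)⁻¹ := by
    intro J t x
    refine (norm_symbolKernel_low_le hΦ t (by positivity) x).trans (le_of_eq ?_)
    rw [div_pow, inv_div]
    ring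
  have hsum : ∀ (t : ℝ) (x : Eucl n), t ≠ 0 → ∀ J : ℕ,
      ‖symbolKernel (fun ξ => beamSymbol t ξ * Φ ((1 / 2 : ℝ) • ξ)) x‖ ≤
        ‖symbolKernel (fun ξ => beamSymbol t ξ * Φ ((2 ^ J / 2 : ℝ) • ξ)) x‖ +
          C * ((2 ^ J : ℝ) ^ n * |t| ^ (-(n / 2 : ℝ))) := by
    intro t x ht J
    induction J with
    | zero => rw [pow_zero]; exact le_add_of_nonneg_right (by positivity)
    | succ J ih =>
      have hb := hC (2 ^ J : ℝ)⁻¹ t x (by positivity) (inv_le_one_of_one_le₀ (one_le_pow₀ (by norm_num))) ht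
      rw [inv_inv, inv_pow, inv_inv] at hb
      have hsplit : (fun ξ => beamSymbol t ξ * Φ ((2 ^ J / 2 : ℝ) • ξ)) = fun ξ =>
          beamSymbol t ξ * Φ ((2 ^ (J + 1) / 2 : ℝ) • ξ) +
            beamSymbol t ξ * annulusCutoff Φ 1 ((2 ^ J : ℝ) • ξ) := by
        ext ξ
        rw [annulusCutoff, smul_smul, one_smul, pow_succ, mul_div_cancel_right₀ _ two_ne_zero,
          one_div_mul_eq_div]
        ring
      have hc1 : Continuous fun ξ : Eucl n => beamSymbol t ξ * Φ ((2 ^ (J + 1) / 2 : ℝ) • ξ) :=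
        (continuous_beamSymbol t).mul (hΦ.continuous_smul _)
      have hc2 : Continuous fun ξ : Eucl n =>
          beamSymbol t ξ * annulusCutoff Φ 1 ((2 ^ J : ℝ) • ξ) :=
        (continuous_beamSymbol t).mul
          ((contDiff_annulusCutoff hΦ 1).continuous.comp (continuous_const_smul _))
      have hs1 : HasCompactSupport fun ξ : Eucl n =>
          beamSymbol t ξ * Φ ((2 ^ (J + 1) / 2 : ℝ) • ξ) :=
        (hΦ.hasCompactSupport_smul (by positivity)).mul_left
      have hs2 : HasCompactSupport fun ξ : Eucl n =>
          beamSymbol t ξ * annulusCutoff Φ 1 ((2 ^ J : ℝ) • ξ) := by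
        refine HasCompactSupport.mul_left ?_
        simp only [annulusCutoff, smul_smul]
        exact (hΦ.hasCompactSupport_smul (by positivity)).sub
          (hΦ.hasCompactSupport_smul (by positivity))
      rw [hsplit, symbolKernel_add hc1 hs1 hc2 hs2] at ih
      have h2n : (2 : ℝ) ≤ 2 ^ n := by
        calc (2 : ℝ) = 2 ^ 1 := by norm_num
          _ ≤ 2 ^ n := pow_le_pow_right₀ (by norm_num) hn
      -- As n ≥ 1, each dyadic step at least doubles the bound. The new block plus the accumulated
      -- sum thus fit under the next term with the same constant.
      have hpow : 2 * (C * ((2 ^ J : ℝ) ^ n * |t| ^ (-(n / 2 : ℝ)))) ≤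
          C * ((2 ^ (J + 1) : ℝ) ^ n * |t| ^ (-(n / 2 : ℝ))) := by
        rw [pow_succ, mul_pow]
        have : 0 ≤ C * ((2 ^ J : ℝ) ^ n * |t| ^ (-(n / 2 : ℝ))) := by positivity
        nlinarith
      have h3 := norm_add_le
        (symbolKernel (fun ξ => beamSymbol t ξ * Φ ((2 ^ (J + 1) / 2 : ℝ) • ξ)) x)
        (symbolKernel (fun ξ => beamSymbol t ξ * annulusCutoff Φ 1 ((2 ^ J : ℝ) • ξ)) x)
      linarith
  refine ⟨2 ^ n * D * 2 ^ n + C, by positivity, fun t x ht => ?_⟩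
  have ht' : 0 < |t| := abs_pos.2 ht
  rcases le_or_gt |t| 1 with h1 | h1
  · have hmin : min 1 (|t| ^ (-(n / 4 : ℝ))) = 1 :=
      min_eq_left (Real.one_le_rpow_of_pos_of_le_one_of_nonpos ht' h1 (by simp; positivity))
    rw [hmin, mul_one]
    have := hlow 0 t x
    rw [pow_zero, one_pow, inv_one, mul_one] at this
    refine this.trans ?_
    have h2n : (1 : ℝ) ≤ 2 ^ n := one_le_pow₀ (by norm_num)
    have : 0 ≤ 2 ^ n * D := by positivity
    nlinarith
  · have hmin : min 1 (|t| ^ (-(n / 4 : ℝ))) = |t| ^ (-(n / 4 : ℝ)) :=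
      min_eq_right (Real.rpow_le_one_of_one_le_of_nonpos h1.le (by simp; positivity))
    rw [hmin]
    -- J is chosen with 2^J ≤ |t|^{1/4} < 2^{J+1}.
    obtain ⟨J, hJ1, hJ2⟩ := exists_nat_pow_near (Real.one_le_rpow h1.le (by norm_num : (0 : ℝ) ≤ 1 / 4))
      (one_lt_two)
    have h4 : (|t| ^ (1 / 4 : ℝ)) ^ n = |t| ^ (n / 4 : ℝ) := by
      rw [← Real.rpow_natCast, ← Real.rpow_mul ht'.le]
      congr 1
      ring
    have e1 : ((2 ^ J : ℝ) ^ n)⁻¹ ≤ 2 ^ n * |t| ^ (-(n / 4 : ℝ)) := by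
      rw [Real.rpow_neg ht'.le, ← h4, ← div_eq_mul_inv, inv_eq_one_div,
        div_le_div_iff₀ (by positivity) (by positivity), one_mul, ← mul_pow]
      refine pow_le_pow_left₀ (by positivity) ?_ n
      rw [pow_succ'] at hJ2
      exact hJ2.le
    have e2 : (2 ^ J : ℝ) ^ n * |t| ^ (-(n / 2 : ℝ)) ≤ |t| ^ (-(n / 4 : ℝ)) := by
      calc (2 ^ J : ℝ) ^ n * |t| ^ (-(n / 2 : ℝ)) ≤
          (|t| ^ (1 / 4 : ℝ)) ^ n * |t| ^ (-(n / 2 : ℝ)) := by gcongr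
        _ = |t| ^ (-(n / 4 : ℝ)) := by
          rw [h4, ← Real.rpow_add ht']
          congr 1
          ring
    refine (hsum t x ht J).trans ?_
    have h5 := (hlow J t x).trans (mul_le_mul_of_nonneg_left e1 (by positivity))
    have h6 := mul_le_mul_of_nonneg_left e2 hC0
    linarith

end LowFrequency

/-! ### Frequency-localised L^{p'} → L^p estimates for B(t) -/

section Blocks

open Filter Topology FourierTransform
open scoped ContDiff

variable {n : ℕ}

theorem distLpNorm_multiplier_le {m : Eucl n → ℝ} (hm : ContDiff ℝ ∞ m) (hs : HasCompactSupport m)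
    (heven : ∀ ξ, m (-ξ) = m ξ) {A₁ A₂ : ℝ} {p p' : ℝ≥0∞} (hA₂ : ∀ ξ, |m ξ| ≤ A₂)
    (hA₁ : ∀ x, ‖symbolKernel m x‖ ≤ A₁) (hA₁0 : 0 < A₁) (hA₂0 : 0 < A₂)
    (hp : 2 ≤ p) (hpp : p⁻¹ + p'⁻¹ = 1) (u : 𝓢'(Eucl n, ℂ)) :
    distLpNorm p (multiplier m u) ≤
      ENNReal.ofReal (A₂ ^ (1 - 2 * delta p) * A₁ ^ (2 * delta p)) * distLpNorm p' u := by
  lift A₁ to ℝ≥0 using hA₁0.le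
  lift A₂ to ℝ≥0 using hA₂0.le
  rw [← NNReal.coe_rpow, ← NNReal.coe_rpow, ← NNReal.coe_mul, ENNReal.ofReal_coe_nnreal]
  have hpi : (0 : ℝ) < 2 * Real.pi := by positivity
  have hM1 : HasCompactSupport fun ξ : Eucl n => ((m ((2 * Real.pi) • ξ) : ℝ) : ℂ) :=
    (hs.comp_smul hpi.ne').comp_left Complex.ofReal_zero
  have hM2 : ContDiff ℝ ∞ fun ξ : Eucl n => ((m ((2 * Real.pi) • ξ) : ℝ) : ℂ) :=
    Complex.ofRealCLM.contDiff.comp (hm.comp (contDiff_const_smul _))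
  set M : 𝓢(Eucl n, ℂ) := hM1.toSchwartzMap hM2 with hMdef
  have hMc : ∀ ξ, M ξ = ((m ((2 * Real.pi) • ξ) : ℝ) : ℂ) := fun ξ => rfl
  have hmul : multiplier m u = TemperedDistribution.fourierMultiplierCLM ℂ M u := rfl
  rw [hmul]
  refine distLpNorm_fourierMultiplier_le M ?_ ?_ ?_ (by exact_mod_cast hA₁0.ne')
    (by exact_mod_cast hA₂0.ne') hp hpp u
  · intro ξ
    rw [hMc, hMc, smul_neg, heven]
  · intro ξ
    rw [hMc, Complex.norm_real]
    exact hA₂ _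
  · intro x
    have h1 : (𝓕⁻ M : 𝓢(Eucl n, ℂ)) x = (((2 * Real.pi) ^ n)⁻¹ : ℝ) • symbolKernel m x := by
      have hsub := Measure.integral_comp_smul (volume : Measure (Eucl n))
        (fun ξ => Complex.exp (Complex.I * ((inner ℝ x ξ : ℝ) : ℂ)) * (m ξ : ℂ)) (2 * Real.pi)
      rw [finrank_euclideanSpace_fin, abs_of_nonneg (by positivity)] at hsub
      rw [symbolKernel, ← hsub, SchwartzMap.fourierInv_coe, Real.fourierInv_eq']
      congr 1 with ξ
      rw [hMc, smul_eq_mul, inner_smul_right, real_inner_comm, mul_comm Complex.I]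
    rw [h1, norm_smul, Real.norm_of_nonneg (by positivity)]
    -- The change to angular frequency costs a factor (2π)^{-n} ≤ 1, which is discarded.
    refine (mul_le_of_le_one_left (norm_nonneg _) ?_).trans (hA₁ x)
    exact inv_le_one_of_one_le₀ (one_le_pow₀ (by linarith [Real.pi_gt_three]))

theorem beamSymbol_neg (t : ℝ) (ξ : Eucl n) : beamSymbol t (-ξ) = beamSymbol t ξ := by
  simp [beamSymbol, omegaSymbol]

theorem IsCutoff.smul_neg_eq {Φ : Eucl n → ℝ} (hΦ : IsCutoff Φ) (c : ℝ) (ξ : Eucl n) :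
    Φ (c • -ξ) = Φ (c • ξ) :=
  hΦ.radial _ _ (by rw [smul_neg, norm_neg])

theorem annulusCutoff_neg {Φ : Eucl n → ℝ} (hΦ : IsCutoff Φ) (c d : ℝ) (ξ : Eucl n) :
    annulusCutoff Φ c (d • -ξ) = annulusCutoff Φ c (d • ξ) := by
  simp only [annulusCutoff, smul_smul, hΦ.smul_neg_eq]

theorem abs_annulusCutoff_le {Φ : Eucl n → ℝ} (hΦ : IsCutoff Φ) (c : ℝ) (ξ : Eucl n) :
    |annulusCutoff Φ c ξ| ≤ 1 := by
  rw [annulusCutoff, abs_le]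
  have h1 := hΦ.nonneg ((1 / 2 : ℝ) • ξ)
  have h2 := hΦ.le_one ((1 / 2 : ℝ) • ξ)
  have h3 := hΦ.nonneg (c • ξ)
  have h4 := hΦ.le_one (c • ξ)
  constructor <;> linarith

theorem multiplier_multiplier {m₁ m₂ : Eucl n → ℝ} (h1 : m₁.HasTemperateGrowth)
    (h2 : m₂.HasTemperateGrowth) (u : 𝓢'(Eucl n, ℂ)) :
    multiplier m₁ (multiplier m₂ u) = multiplier (fun ξ => m₁ ξ * m₂ ξ) u := by
  simp only [multiplier]
  rw [TemperedDistribution.fourierMultiplierCLM_fourierMultiplierCLM_apply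
    (hasTemperateGrowth_rescaled h2) (hasTemperateGrowth_rescaled h1)]
  congr 2
  ext ξ
  simp [mul_comm]

theorem IsCutoff.hasTemperateGrowth_smul {Φ : Eucl n → ℝ} (hΦ : IsCutoff Φ) {c : ℝ} (hc : 0 < c) :
    (fun ξ => Φ (c • ξ)).HasTemperateGrowth :=
  (hΦ.hasCompactSupport_smul hc).hasTemperateGrowth (hΦ.smooth.comp (contDiff_const_smul _))

theorem lowProj_beamOp {Φ : Eucl n → ℝ} (hΦ : IsCutoff Φ) (t : ℝ) (g : 𝓢'(Eucl n, ℂ)) :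
    lowProj Φ (beamOp t g) =
      multiplier (fun ξ => beamSymbol t ξ * Φ ((1 / 2 : ℝ) • ξ)) (lowProj Φ g) := by
  have h0 : Φ.HasTemperateGrowth := by
    simpa using hΦ.hasTemperateGrowth_smul one_pos
  have hB := hasTemperateGrowth_beamSymbol (n := n) t
  rw [lowProj, beamOp, multiplier_multiplier h0 hB,
    multiplier_multiplier
    (m₁ := fun ξ => beamSymbol t ξ * Φ ((1 / 2 : ℝ) • ξ))
    (hB.mul (hΦ.hasTemperateGrowth_smul (by norm_num))) h0]
  congr 2
  ext ξ
  rcases le_or_gt ‖ξ‖ 2 with h | h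
  · rw [hΦ.smul_eq_one (by norm_num) (by linarith)]
    ring
  · rw [hΦ.eq_zero h]
    ring

/-- The fattened cutoff equals 1 wherever ψ is nonzero, so it can be inserted freely. It makes the
multiplier compactly supported while the projection stays on g, as the right-hand Besov norm
requires. -/
theorem dyadicProj_beamOp {Φ : Eucl n → ℝ} (hΦ : IsCutoff Φ) (t : ℝ) (k : ℤ)
    (g : 𝓢'(Eucl n, ℂ)) :
    dyadicProj Φ k (beamOp t g) =
      multiplier (fun ξ => beamSymbol t ξ * annulusCutoff Φ 4 (((2 : ℝ) ^ k)⁻¹ • ξ))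
        (dyadicProj Φ k g) := by
  have hB := hasTemperateGrowth_beamSymbol (n := n) t
  have hk : (0 : ℝ) < 2 ^ (-k) := by positivity
  have h0 : (fun ξ => Φ ((2 : ℝ) ^ (-k) • ξ) -
      Φ ((2 : ℝ) • ((2 : ℝ) ^ (-k) • ξ))).HasTemperateGrowth := by
    simp only [smul_smul]
    exact (hΦ.hasTemperateGrowth_smul hk).sub (hΦ.hasTemperateGrowth_smul (by positivity))
  have h1 : (fun ξ => annulusCutoff Φ 4 (((2 : ℝ) ^ k)⁻¹ • ξ)).HasTemperateGrowth := by
    simp only [smul_smul, annulusCutoff]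
    exact (hΦ.hasTemperateGrowth_smul (by positivity)).sub
      (hΦ.hasTemperateGrowth_smul (by positivity))
  rw [dyadicProj, beamOp, multiplier_multiplier h0 hB, multiplier_multiplier
    (m₁ := fun ξ => beamSymbol t ξ * annulusCutoff Φ 4 (((2 : ℝ) ^ k)⁻¹ • ξ)) (hB.mul h1) h0]
  congr 2
  ext ξ
  rw [← zpow_neg]
  generalize (2 : ℝ) ^ (-k) • ξ = ζ
  rcases le_or_gt ‖ζ‖ (1 / 2) with h | h
  · rw [hΦ.eq_one ζ (by linarith), hΦ.smul_eq_one (by norm_num) (by linarith)]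
    ring
  rcases le_or_gt ‖ζ‖ 2 with h' | h'
  · rw [annulusCutoff, hΦ.smul_eq_zero (c := 4) (by norm_num) (by linarith),
      hΦ.smul_eq_one (c := 1 / 2) (by norm_num) (by linarith)]
    ring
  · rw [hΦ.eq_zero h', hΦ.smul_eq_zero (by norm_num) (by linarith)]
    ring

/-- The interpolated constant when the L² bound is C x and the kernel bound is C x y: only the gain
y receives the exponent d, and C does not depend on p. -/
theorem mul_rpow_interp {C x y d : ℝ} (hC : 0 < C) (hx : 0 < x) (hy : 0 ≤ y) :
    (C * x) ^ (1 - d) * (C * (x * y)) ^ d = C * (x * y ^ d) := by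
  rw [← mul_assoc, Real.mul_rpow (by positivity) hy, ← mul_assoc, ← Real.rpow_add (by positivity)]
  simp [mul_assoc]

/-- The frequency-localised estimate at low frequency. -/
theorem exists_distLpNorm_lowProj_le (hn : 1 ≤ n) {Φ : Eucl n → ℝ} (hΦ : IsCutoff Φ) :
    ∃ C : ℝ, 1 ≤ C ∧ ∀ (p p' : ℝ≥0∞) (t : ℝ) (g : 𝓢'(Eucl n, ℂ)), 2 ≤ p → p⁻¹ + p'⁻¹ = 1 → t ≠ 0 →
      distLpNorm p (lowProj Φ (beamOp t g)) ≤
        ENNReal.ofReal (C * (min 1 (|t| ^ (-(n / 4 : ℝ)))) ^ (2 * delta p)) *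
          distLpNorm p' (lowProj Φ g) := by
  obtain ⟨C, hC0, hC⟩ := exists_symbolKernel_low_bound hn hΦ
  refine ⟨max C 1, le_max_right _ _, fun p p' t g hp hpp ht => ?_⟩
  have ht' : 0 < |t| := abs_pos.2 ht
  have hD : 0 < max C 1 := by positivity
  set D := max C 1
  have hDC : C ≤ D := le_max_left _ _
  have hD1 : 1 ≤ D := le_max_right _ _
  set y := min 1 (|t| ^ (-(n / 4 : ℝ))) with hy
  have hy0 : 0 < y := lt_min one_pos (by positivity)
  rw [lowProj_beamOp hΦ]
  have h := distLpNorm_multiplier_le (m := fun ξ => beamSymbol t ξ * Φ ((1 / 2 : ℝ) • ξ))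
    (A₂ := D * 1) (A₁ := D * (1 * y))
    ((hasTemperateGrowth_beamSymbol t).1.mul (hΦ.smooth.comp (contDiff_const_smul _)))
    (hΦ.hasCompactSupport_smul (by norm_num)).mul_left
    (fun ξ => by rw [beamSymbol_neg, hΦ.smul_neg_eq]) ?_ ?_ ?_ ?_ hp hpp (lowProj Φ g)
  · refine h.trans (le_of_eq ?_)
    rw [mul_rpow_interp hD one_pos hy0.le, one_mul]
  · intro ξ
    rw [abs_mul, mul_one]
    have h1 := (abs_beamSymbol_le t ξ).trans (inv_le_one_of_one_le₀ (one_le_omegaSymbol ξ))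
    have h2 : |Φ ((1 / 2 : ℝ) • ξ)| ≤ 1 := by
      rw [abs_of_nonneg (hΦ.nonneg _)]
      exact hΦ.le_one _
    exact (mul_le_one₀ h1 (abs_nonneg _) h2).trans hD1
  · intro x
    rw [one_mul]
    exact (hC t x ht).trans (by gcongr)
  · positivity
  · positivity

/-- The frequency-localised estimate at frequency `2 ^ k`. -/
theorem exists_distLpNorm_dyadicProj_le (hn : 1 ≤ n) {Φ : Eucl n → ℝ} (hΦ : IsCutoff Φ) :
    ∃ C : ℝ, 1 ≤ C ∧ ∀ (p p' : ℝ≥0∞) (t : ℝ) (k : ℕ) (g : 𝓢'(Eucl n, ℂ)), 2 ≤ p →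
      p⁻¹ + p'⁻¹ = 1 → t ≠ 0 → distLpNorm p (dyadicProj Φ (k : ℤ) (beamOp t g)) ≤
        ENNReal.ofReal (C * ((((2 : ℝ) ^ k) ^ 2)⁻¹ *
          (min (((2 : ℝ) ^ k) ^ n) (|t| ^ (-(n / 2 : ℝ)))) ^ (2 * delta p))) *
          distLpNorm p' (dyadicProj Φ (k : ℤ) g) := by
  obtain ⟨C, hC0, hC⟩ := exists_symbolKernel_high_bound hn (contDiff_annulusCutoff hΦ 4)
    (annulusCutoff_eq_zero hΦ (by norm_num) (by norm_num))
  -- On the annulus |ξ| ≥ ρ/4, hence ω ≥ ρ²/16 and the symbol is at most 16ρ^{-2}.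
  refine ⟨max C 16, le_max_of_le_right (by norm_num), fun p p' t k g hp hpp ht => ?_⟩
  have ht' : 0 < |t| := abs_pos.2 ht
  have hD : 0 < max C 16 := by positivity
  set D := max C 16
  have hDC : C ≤ D := le_max_left _ _
  have hD1 : 16 ≤ D := le_max_right _ _
  have hρ1 : (1 : ℝ) ≤ 2 ^ k := one_le_pow₀ (by norm_num)
  rw [dyadicProj_beamOp hΦ, zpow_natCast]
  set ρ : ℝ := 2 ^ k with hρ
  have hρ0 : 0 < ρ := by linarith
  set y := min (ρ ^ n) (|t| ^ (-(n / 2 : ℝ))) with hy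
  have hy0 : 0 < y := lt_min (by positivity) (by positivity)
  have h := distLpNorm_multiplier_le
    (m := fun ξ => beamSymbol t ξ * annulusCutoff Φ 4 (ρ⁻¹ • ξ))
    (A₂ := D * (ρ ^ 2)⁻¹) (A₁ := D * ((ρ ^ 2)⁻¹ * y))
    ((hasTemperateGrowth_beamSymbol t).1.mul
      ((contDiff_annulusCutoff hΦ 4).comp (contDiff_const_smul _))) ?_
    (fun ξ => by rw [beamSymbol_neg, annulusCutoff_neg hΦ]) ?_ ?_ ?_ ?_ hp hpp
      (dyadicProj Φ (k : ℤ) g)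
  · refine h.trans (le_of_eq ?_)
    rw [mul_rpow_interp hD (by positivity) hy0.le]
  · refine HasCompactSupport.mul_left ?_
    simp only [annulusCutoff, smul_smul]
    exact (hΦ.hasCompactSupport_smul (by positivity)).sub
      (hΦ.hasCompactSupport_smul (by positivity))
  · intro ξ
    by_cases h : 1 / 4 ≤ ‖ρ⁻¹ • ξ‖ ∧ ‖ρ⁻¹ • ξ‖ ≤ 4
    · have h1 : ρ / 4 ≤ ‖ξ‖ := by
        have := h.1
        rw [norm_smul, norm_inv, Real.norm_of_nonneg hρ0.le, ← div_eq_inv_mul,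
          le_div_iff₀ hρ0] at this
        linarith
      have h2 : ρ ^ 2 / 16 ≤ omegaSymbol ξ := by
        refine le_trans ?_ (sq_norm_le_omegaSymbol ξ)
        nlinarith
      have h3 : |beamSymbol t ξ| ≤ 16 * (ρ ^ 2)⁻¹ := by
        refine (abs_beamSymbol_le t ξ).trans ((inv_anti₀ (by positivity) h2).trans (le_of_eq ?_))
        rw [inv_div]
        ring
      rw [abs_mul]
      calc |beamSymbol t ξ| * |annulusCutoff Φ 4 (ρ⁻¹ • ξ)| ≤ 16 * (ρ ^ 2)⁻¹ * 1 := by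
            gcongr
            exact abs_annulusCutoff_le hΦ _ _
        _ ≤ D * (ρ ^ 2)⁻¹ := by rw [mul_one]; gcongr
    · rw [annulusCutoff_eq_zero hΦ (by norm_num) (by norm_num) _ h, mul_zero, abs_zero]
      positivity
  · intro x
    exact (hC ρ t x hρ1 ht).trans (by gcongr)
  · positivity
  · positivity

end Blocks

/-! ### Absorbing the block bounds into k(t) and summing over blocks -/

section Summation

variable {n : ℕ}

/-- The real-valued decay factor. -/
def decayReal (n : ℕ) (d s s' t : ℝ) : ℝ :=
  if |t| ≤ 1 then |t| ^ (min (1 + s' / 2 - s / 2 - n * d) 0) else |t| ^ (-(n * d / 2))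

theorem decayFactor_eq (p : ℝ≥0∞) (s s' : ℝ) {t : ℝ} (ht : t ≠ 0) :
    decayFactor n p s s' t = ENNReal.ofReal (decayReal n (delta p) s s' t) := by
  have ht' : 0 < |t| := abs_pos.2 ht
  unfold decayFactor decayReal
  split_ifs <;> rw [ENNReal.ofReal_rpow_of_pos ht']

/-- For |t| ≤ 1 the left side is at most 1, while k(t) ≥ 1. For |t| ≥ 1 the exponent is (n/4)(2δ) =
nδ/2: low frequencies fix the long-time rate. -/
theorem min_rpow_le_decayReal_low (n : ℕ) {d s s' t : ℝ} (hd : 0 ≤ d) (ht : t ≠ 0) :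
    (min 1 (|t| ^ (-(n / 4 : ℝ)))) ^ (2 * d) ≤ decayReal n d s s' t := by
  have ht' : 0 < |t| := abs_pos.2 ht
  have h0 : 0 ≤ min 1 (|t| ^ (-(n / 4 : ℝ))) := by positivity
  unfold decayReal
  split_ifs with h
  · refine (Real.rpow_le_one h0 (min_le_left _ _) (by positivity)).trans ?_
    exact Real.one_le_rpow_of_pos_of_le_one_of_nonpos ht' h (min_le_right _ _)
  · refine (Real.rpow_le_rpow h0 (min_le_right _ _) (by positivity)).trans (le_of_eq ?_)
    rw [← Real.rpow_mul ht'.le]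
    congr 1
    ring

/-- Put a = 2 + s' - s ≥ 0 and y = min(ρ^n, |t|^{-n/2}); the claim is y^{2d} ≤ k(t) ρ^a. For |t| > 1
the time bound gives |t|^{-nd}, better than needed. For |t| ≤ 1 and a ≥ 2nd the frequency bound
ρ^{2nd} suffices; otherwise the two bounds on y are mixed. -/
theorem min_rpow_le_decayReal_high {n : ℕ} (hn : 1 ≤ n) {d s s' t ρ : ℝ} (hd : 0 ≤ d)
    (hs : 0 ≤ 2 + s' - s) (ht : t ≠ 0) (hρ : 1 ≤ ρ) :
    (ρ ^ 2)⁻¹ * (min (ρ ^ n) (|t| ^ (-(n / 2 : ℝ)))) ^ (2 * d) ≤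
      decayReal n d s s' t * ρ ^ (s' - s) := by
  have ht' : 0 < |t| := abs_pos.2 ht
  have hρ0 : 0 < ρ := by linarith
  have hn' : (0 : ℝ) < n := by exact_mod_cast hn
  set y := min (ρ ^ n) (|t| ^ (-(n / 2 : ℝ))) with hy
  have hy0 : 0 < y := lt_min (by positivity) (by positivity)
  have hyρ : y ≤ ρ ^ n := min_le_left _ _
  have hyt : y ≤ |t| ^ (-(n / 2 : ℝ)) := min_le_right _ _
  have hpow : ρ ^ (s' - s) = (ρ ^ 2)⁻¹ * ρ ^ (2 + s' - s) := by
    rw [← Real.rpow_natCast, ← Real.rpow_neg hρ0.le, ← Real.rpow_add hρ0]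
    congr 1
    push_cast
    ring
  rw [hpow, mul_left_comm]
  refine mul_le_mul_of_nonneg_left ?_ (by positivity)
  have hρa : 1 ≤ ρ ^ (2 + s' - s) := Real.one_le_rpow hρ hs
  have hρn : ∀ α : ℝ, 0 ≤ α → y ^ α ≤ ρ ^ (n * α) := fun α hα => by
    refine (Real.rpow_le_rpow hy0.le hyρ hα).trans (le_of_eq ?_)
    rw [← Real.rpow_natCast, ← Real.rpow_mul hρ0.le]
  have htn : ∀ α : ℝ, 0 ≤ α → y ^ α ≤ |t| ^ (-(n / 2 * α)) := fun α hα => by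
    refine (Real.rpow_le_rpow hy0.le hyt hα).trans (le_of_eq ?_)
    rw [← Real.rpow_mul ht'.le, neg_mul]
  unfold decayReal
  split_ifs with h
  · rcases le_total 0 (1 + s' / 2 - s / 2 - n * d) with h1 | h1
    · rw [min_eq_right h1, Real.rpow_zero, one_mul]
      refine (hρn _ (by positivity)).trans (Real.rpow_le_rpow_of_exponent_le hρ ?_)
      linarith
    · rw [min_eq_left h1]
      have hα : 0 ≤ (2 + s' - s) / n := by positivity
      have hβ : 0 ≤ 2 * d - (2 + s' - s) / n := by
        rw [sub_nonneg, div_le_iff₀ hn']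
        linarith
      -- The share a/n of the exponent goes to the bound y ≤ ρ^n and produces exactly ρ^a. The rest
      -- goes to y ≤ |t|^{-n/2} and produces |t|^{a/2 - nd}.
      have e : 2 * d = (2 * d - (2 + s' - s) / n) + (2 + s' - s) / n := by ring
      rw [e, Real.rpow_add hy0]
      refine (mul_le_mul (htn _ hβ) (hρn _ hα) (by positivity) (by positivity)).trans (le_of_eq ?_)
      congr 2
      · field_simp
        ring
      · field_simp
  · refine (htn _ (by positivity)).trans ?_
    refine le_trans (Real.rpow_le_rpow_of_exponent_le (not_le.1 h).le ?_)
      (le_mul_of_one_le_right (by positivity) hρa)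
    nlinarith [mul_nonneg hn'.le hd]

theorem distLpNorm_zero (p : ℝ≥0∞) : distLpNorm p (0 : 𝓢'(Eucl n, ℂ)) = 0 := by
  refine le_antisymm ?_ bot_le
  refine iInf_le_of_le 0 (iInf_le_of_le MemLp.zero (iInf_le_of_le (fun φ => ?_) ?_))
  · simp
  · simp

theorem beamOp_zero (g : 𝓢'(Eucl n, ℂ)) : beamOp 0 g = 0 := by
  have : (fun ξ : Eucl n => ((beamSymbol 0 ((2 * Real.pi) • ξ) : ℝ) : ℂ)) = fun _ => 0 := by
    ext ξ
    simp [beamSymbol]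
  rw [beamOp, multiplier, this, TemperedDistribution.fourierMultiplierCLM_const]
  simp

/-- Besov norm estimates follow from estimates of the frequency blocks. -/
theorem besovNorm_le_of_blocks (Φ : Eucl n → ℝ) {s s' : ℝ} {p p' q : ℝ≥0∞} (hq : 1 ≤ q)
    {f g : 𝓢'(Eucl n, ℂ)} {c : ℝ≥0∞}
    (hlow : distLpNorm p (lowProj Φ f) ≤ c * distLpNorm p' (lowProj Φ g))
    (hhigh : ∀ k : ℕ, (2 : ℝ≥0∞) ^ (((k + 1 : ℕ) : ℝ) * s) *
        distLpNorm p (dyadicProj Φ ((k + 1 : ℕ) : ℤ) f) ≤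
      c * ((2 : ℝ≥0∞) ^ (((k + 1 : ℕ) : ℝ) * s') *
        distLpNorm p' (dyadicProj Φ ((k + 1 : ℕ) : ℤ) g))) :
    besovNorm Φ s p q f ≤ c * besovNorm Φ s' p' q g := by
  unfold besovNorm
  split_ifs with hq'
  · refine max_le (hlow.trans (by gcongr; exact le_max_left _ _)) (iSup_le fun k => ?_)
    refine (hhigh k).trans ?_
    gcongr
    refine le_max_of_le_right ?_
    exact le_iSup (fun k : ℕ => (2 : ℝ≥0∞) ^ (((k + 1 : ℕ) : ℝ) * s') *
        distLpNorm p' (dyadicProj Φ ((k + 1 : ℕ) : ℤ) g)) k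
  · have hq0 : 0 < q.toReal := ENNReal.toReal_pos (zero_lt_one.trans_le hq).ne' hq'
    have hc : c = (c ^ q.toReal) ^ (1 / q.toReal) := by
      rw [← ENNReal.rpow_mul, mul_one_div_cancel hq0.ne', ENNReal.rpow_one]
    conv_rhs => rw [hc]
    rw [← ENNReal.mul_rpow_of_nonneg _ _ (by positivity)]
    refine ENNReal.rpow_le_rpow ?_ (by positivity)
    rw [mul_add, ← ENNReal.tsum_mul_left]
    refine add_le_add ?_ (ENNReal.tsum_le_tsum fun k => ?_)
    · rw [← ENNReal.mul_rpow_of_nonneg _ _ hq0.le]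
      exact ENNReal.rpow_le_rpow hlow hq0.le
    · rw [ENNReal.rpow_mul _ (_ * s), ENNReal.rpow_mul _ (_ * s'), ← ENNReal.mul_rpow_of_nonneg _ _ hq0.le,
        ← ENNReal.mul_rpow_of_nonneg _ _ hq0.le, ← ENNReal.mul_rpow_of_nonneg _ _ hq0.le]
      exact ENNReal.rpow_le_rpow (hhigh k) hq0.le

end Summation

end BeamBesov

end

/-! ### The Besov space estimate -/

theorem proposition3 (n : ℕ) (hn : 1 ≤ n) (Φ : BeamBesov.Eucl n → ℝ)
    (hΦ : BeamBesov.IsCutoff Φ) :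
    ∃ C : ℝ≥0, ∀ (p p' q : ℝ≥0∞) (s s' : ℝ), 2 ≤ p → p⁻¹ + p'⁻¹ = 1 → 1 ≤ q →
      0 ≤ 2 + s' - s →
      ∀ (t : ℝ) (g : 𝓢'(BeamBesov.Eucl n, ℂ)),
        BeamBesov.besovNorm Φ s p q (BeamBesov.beamOp t g) ≤
          C * BeamBesov.decayFactor n p s s' t * BeamBesov.besovNorm Φ s' p' q g := by
  obtain ⟨C₁, hC₁, hlow⟩ := BeamBesov.exists_distLpNorm_lowProj_le hn hΦ
  obtain ⟨C₂, hC₂, hhigh⟩ := BeamBesov.exists_distLpNorm_dyadicProj_le hn hΦ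
  have hC0 : 0 ≤ max C₁ C₂ := by positivity
  obtain ⟨C, hC⟩ : ∃ C : ℝ≥0, (C : ℝ) = max C₁ C₂ := ⟨⟨_, hC0⟩, rfl⟩
  refine ⟨C, fun p p' q s s' hp hpp hq hs t g => ?_⟩
  refine BeamBesov.besovNorm_le_of_blocks Φ hq ?_ fun k => ?_
  -- At t = 0 the factor k may be ∞ and multiply a zero norm. This is harmless, since `B(0) = 0`
  -- makes the left side vanish.
  · rcases eq_or_ne t 0 with rfl | ht
    · rw [BeamBesov.beamOp_zero, map_zero, BeamBesov.distLpNorm_zero]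
      exact zero_le
    refine (hlow p p' t g hp hpp ht).trans ?_
    gcongr
    rw [BeamBesov.decayFactor_eq p s s' ht, ← ENNReal.ofReal_coe_nnreal,
      ← ENNReal.ofReal_mul NNReal.zero_le_coe]
    refine ENNReal.ofReal_le_ofReal ?_
    rw [hC]
    refine mul_le_mul (le_max_left _ _)
      (BeamBesov.min_rpow_le_decayReal_low n (BeamBesov.delta_nonneg hp) ht) (by positivity) hC0
  · rcases eq_or_ne t 0 with rfl | ht
    · rw [BeamBesov.beamOp_zero, map_zero, BeamBesov.distLpNorm_zero, mul_zero]
      exact zero_le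
    have h := hhigh p p' t (k + 1) g hp hpp ht
    have hρ : (1 : ℝ) ≤ 2 ^ (k + 1) := one_le_pow₀ (by norm_num)
    have hb := BeamBesov.min_rpow_le_decayReal_high hn (BeamBesov.delta_nonneg hp) hs ht hρ
    -- With ρ = 2^{k+1}, the factor ρ^{s'-s} of the block bound is exactly what turns the weight of
    -- order s into that of order s'.
    have hk : (2 : ℝ≥0∞) ^ (((k + 1 : ℕ) : ℝ) * s') = (2 : ℝ≥0∞) ^ (((k + 1 : ℕ) : ℝ) * s) *
        ENNReal.ofReal (((2 : ℝ) ^ (k + 1)) ^ (s' - s)) := by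
      rw [← Real.rpow_natCast 2 (k + 1), ← Real.rpow_mul (by norm_num),
        ← ENNReal.ofReal_rpow_of_pos (by norm_num), ENNReal.ofReal_ofNat,
        ← ENNReal.rpow_add _ _ (by norm_num) (by norm_num)]
      congr 1
      ring
    have hA : ENNReal.ofReal (C₂ * ((((2 : ℝ) ^ (k + 1)) ^ 2)⁻¹ *
        (min (((2 : ℝ) ^ (k + 1)) ^ n) (|t| ^ (-(n / 2 : ℝ)))) ^ (2 * BeamBesov.delta p))) ≤
        (C : ℝ≥0∞) * BeamBesov.decayFactor n p s s' t *
          ENNReal.ofReal (((2 : ℝ) ^ (k + 1)) ^ (s' - s)) := by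
      rw [BeamBesov.decayFactor_eq p s s' ht, ← ENNReal.ofReal_coe_nnreal, mul_assoc,
        ← ENNReal.ofReal_mul' (by positivity), ← ENNReal.ofReal_mul NNReal.zero_le_coe]
      refine ENNReal.ofReal_le_ofReal ?_
      rw [hC]
      exact mul_le_mul (le_max_right _ _) hb (by positivity) hC0
    rw [hk]
    refine (mul_le_mul_right (h.trans (mul_le_mul_left hA _)) _).trans (le_of_eq ?_)
    ring
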